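/- Let $d\ge 1$, let $\alpha,\gamma,\nu,r,\beta,\rho,B>0$ and $\xi\in(0,1)$. Let $f:\mathbb R^d\to\mathbb R$ be twice continuously differentiable with the following properties. - $f$ is $(\alpha,\gamma,\nu,r)$-strict-saddle: for every $x\in\mathbb R^d$, either $\|\nabla f(x)\|\ge\nu$, or $\lambda_{\min}(\nabla^2 f(x))\le-\gamma$, or there is a local minimum $x^*$ of $f$ with $\|x-x^*\|\le r$ such that $f$ restricted to the ball of radius $2r$ around $x^*$ is $\alpha$-strongly convex, i.e. $f(z)-f(y)\ge\nabla f(y)^\top(z-y)+\frac{\alpha}{2}\|y-z\|^2$ for all $y,z$ in this ball. - $\|\nabla f(x)-\nabla f(y)\|\le\beta\|x-y\|$ and $\|\nabla^2 f(x)-\nabla^2 f(y)\|\le\rho\|x-y\|$ (spectral norm) for all $x,y$. - $|f(x)|\le B$ for all $x$. Saddle-NGD with learning rate $\eta$, noise level $\theta$, noise period $N_0\in\mathbb N$ and starting point $x_0\in\mathbb R^d$ is the iteration $$x_{t+1}=x_t-\eta\,\frac{\nabla f(x_t)}{\|\nabla f(x_t)\|}+\theta n_t ,$$ where $n_t\sim\mathcal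 N(0,I_d)$ independently if $N_0\mid t$, and $n_t=0$ otherwise (the normalized gradient is taken to be $0$ where $\nabla f(x_t)=0$). Write $u=\tilde O(v)$ if $u\le C L^k v$ with constants $C>0$ and $k\in\mathbb N$ that do not depend on $d,\alpha,\gamma,\nu,r,\beta,\rho,B,\xi$, where $$L=1+\sum_{c\in\{\alpha,\gamma,\nu,r,\beta,\rho,B\}}(c+c^{-1})+\log d+\log(1/\xi),$$ and $u=\tilde\Theta(v)$ if $u=\tilde O(v)$ and $v=\tilde O(u)$. All quantities $\bar\eta,\eta_{\max},s,\eta,\theta,N_0,T_{\rm tot}$ below depend only on $(d,\alpha,\gamma,\nu,r,\beta,\rho,B,\xi)$, not on $f$ or $x_0$. There is a threshold $\bar\eta=\tilde\Theta(1/d^2)$ such that for every choice of $\eta_{\max}=\tilde\Theta(1/d^2)$ with $\eta_{\max}\le\bar\eta$ and every $s=\tilde\Theta(r^2)$ the following holds for the learning rate $\eta=\min\{\eta_{\max},s\}$. There are $\theta=\tilde\Theta(\eta)$, $N_0=\tilde\Theta(\eta^{-1/2})$ and a number of steps $T_{\rm tot}$ with $$T_{\rm tot}=\tilde O(\eta_{\max}^{-3/2})\quad\text{and}\quad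 T_{\rm tot}=\tilde O(d^3)$$ such that, for every $f$ as above and every $x_0\in\mathbb R^d$, with probability at least $1-\xi$ there are a $t\le T_{\rm tot}$ and a local minimum $x^*$ of $f$ with $\|x_t-x^*\|\le r$. -/

import Mathlib

open MeasureTheory ProbabilityTheory

noncomputable section

namespace SaddleNGD

/-- The constants of the problem: the dimension, the strict-saddle constants `α, γ, ν, r`, the
smoothness constant `β`, the Lipschitz constant `ρ` of the Hessian, the bound `B` on the values of
the objective, and the allowed failure probability `ξ`. -/
structure Params where
  d : ℕ
  α : ℝ
  γ : ℝ
  ν : ℝ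
  r : ℝ
  β : ℝ
  ρ : ℝ
  B : ℝ
  ξ : ℝ
  d_pos : 1 ≤ d
  α_pos : 0 < α
  γ_pos : 0 < γ
  ν_pos : 0 < ν
  r_pos : 0 < r
  β_pos : 0 < β
  ρ_pos : 0 < ρ
  B_pos : 0 < B
  ξ_pos : 0 < ξ
  ξ_lt_one : ξ < 1

/-- The space `ℝ^d` with its Euclidean norm. -/
abbrev Params.E (p : Params) : Type := EuclideanSpace ℝ (Fin p.d)

/-- The quantity whose powers bound the factors hidden by soft-O notation. The dimension and
the failure probability enter only through `log d` and `log (1/ξ)`. -/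
def Params.hidden (p : Params) : ℝ :=
  1 + (p.α + p.α⁻¹) + (p.γ + p.γ⁻¹) + (p.ν + p.ν⁻¹) + (p.r + p.r⁻¹) + (p.β + p.β⁻¹)
    + (p.ρ + p.ρ⁻¹) + (p.B + p.B⁻¹) + Real.log p.d + Real.log (1 / p.ξ)

/-- `u = Õ(v)`: one polynomial in the hidden quantities serves for all values of the constants. -/
def SoftO (u v : Params → ℝ) : Prop :=
  ∃ (C : ℝ) (k : ℕ), 0 < C ∧ ∀ p : Params, u p ≤ C * p.hidden ^ k * v p

/-- `u = Θ̃(v)`. -/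
def SoftTheta (u v : Params → ℝ) : Prop :=
  SoftO u v ∧ SoftO v u

variable {d : ℕ}

/-- The Hessian of `f` at `x`, as a linear operator; its operator norm is the spectral norm. -/
def hessian (f : EuclideanSpace ℝ (Fin d) → ℝ) (x : EuclideanSpace ℝ (Fin d)) :
    EuclideanSpace ℝ (Fin d) →L[ℝ] EuclideanSpace ℝ (Fin d) :=
  fderiv ℝ (gradient f) x

/-- The smallest eigenvalue of an operator (of interest for symmetric operators and `1 ≤ d`, whose
set of eigenvalues is finite and nonempty). -/
def lambdaMin (A : EuclideanSpace ℝ (Fin d) →L[ℝ] EuclideanSpace ℝ (Fin d)) : ℝ :=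
  sInf {μ : ℝ | Module.End.HasEigenvalue (A : Module.End ℝ (EuclideanSpace ℝ (Fin d))) μ}

/-- `f` restricted to `s` is `α`-strongly convex. -/
def StronglyConvexOn (α : ℝ) (s : Set (EuclideanSpace ℝ (Fin d)))
    (f : EuclideanSpace ℝ (Fin d) → ℝ) : Prop :=
  ∀ x ∈ s, ∀ y ∈ s, inner ℝ (gradient f x) (y - x) + α / 2 * ‖x - y‖ ^ 2 ≤ f y - f x

/-- The `(α, γ, ν, r)`-strict-saddle property. -/
def StrictSaddle (α γ ν r : ℝ) (f : EuclideanSpace ℝ (Fin d) → ℝ) : Prop :=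
  ∀ x, ν ≤ ‖gradient f x‖ ∨ lambdaMin (hessian f x) ≤ -γ ∨
    ∃ xs, IsLocalMin f xs ∧ ‖x - xs‖ ≤ r ∧ StronglyConvexOn α (Metric.closedBall xs (2 * r)) f

/-- The assumptions on the objective: it is twice continuously differentiable, strict-saddle,
`β`-smooth, has a `ρ`-Lipschitz Hessian, and is bounded by `B` in absolute value. -/
structure Objective (p : Params) (f : p.E → ℝ) : Prop where
  contDiff : ContDiff ℝ 2 f
  strictSaddle : StrictSaddle p.α p.γ p.ν p.r f
  smooth : ∀ x y, ‖gradient f x - gradient f y‖ ≤ p.β * ‖x - y‖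
  lipschitzHessian : ∀ x y, ‖hessian f x - hessian f y‖ ≤ p.ρ * ‖x - y‖
  bounded : ∀ x, |f x| ≤ p.B

/-- The iterates `x_t` of Saddle-NGD with learning rate `η`, noise level `θ`, noise period `N₀`,
starting point `x₀` and noise vectors `n_t` (those with `N₀ ∤ t` are not used). Where the gradient
vanishes, the normalized gradient is taken to be `0`. -/
def iterate (f : EuclideanSpace ℝ (Fin d) → ℝ) (η θ : ℝ) (N₀ : ℕ)
    (x₀ : EuclideanSpace ℝ (Fin d)) (n : ℕ → EuclideanSpace ℝ (Fin d)) :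
    ℕ → EuclideanSpace ℝ (Fin d)
  | 0 => x₀
  | t + 1 =>
    iterate f η θ N₀ x₀ n t
      - η • (‖gradient f (iterate f η θ N₀ x₀ n t)‖⁻¹ • gradient f (iterate f η θ N₀ x₀ n t))
      + θ • (if t % N₀ = 0 then n t else 0)

/-- The noise vectors `n_t` are independent standard Gaussian vectors. -/
def IsGaussianNoise {Ω : Type*} [MeasurableSpace Ω] (P : Measure Ω)
    (n : ℕ → Ω → EuclideanSpace ℝ (Fin d)) : Prop :=
  iIndepFun n P ∧ ∀ t, HasLaw (n t) (stdGaussian (EuclideanSpace ℝ (Fin d))) P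

/-- Within the first `T` steps, `x` comes `r`-close to a local minimum of `f`. -/
def ReachesLocalMin (f : EuclideanSpace ℝ (Fin d) → ℝ) (r : ℝ) (T : ℕ)
    (x : ℕ → EuclideanSpace ℝ (Fin d)) : Prop :=
  ∃ t ≤ T, ∃ xs, IsLocalMin f xs ∧ ‖x t - xs‖ ≤ r

end SaddleNGD

end

/-! Time is cut into noise periods of `N` ≈ `1/√η` steps, with noise only in the first step of each.
The descent inequality along a period reads: final value ≤ initial value + a linear noise term of
mean zero + second-order terms − `η` times the sum of the gradient norms met on the way
(`apply_period_le`). For small `η` the second-order terms are negligible on average, so `f` drops by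
order `η * S` in expectation once that sum is at least `S`, of order `1/log(1/η)`, with probability
at least 1/2.

If the initial gradient is large, this is immediate. At a strict saddle, let `e` be a unit
eigenvector of negative curvature. A normalized step multiplies the component of the gradient along
`e` by at least `1 + η γ / ‖∇f‖`, up to a small error: the smaller the gradient, the faster the
growth. By the Cauchy-Schwarz inequality, a gradient sum below `S` over about `1/√η` steps forces
growth by a factor `1/η`. Gaussian noise makes the initial component at least of order `γ θ` with
probability at least 1/2, because only a short interval of noise values along `e` is bad. The grown
component would then exceed `S`, a contradiction (`le_sum_norm_gradient_of_lambdaMin_le`).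

Since `f` is bounded, a chain whose potential drops in expectation by `δ`, of order `η * S`, cannot
go on for long: the probability of not having left the descent region halves every `O(B/δ)` periods
(`measureReal_forall_mem_le`). Outside this region the strict-saddle property leaves only the
neighbourhood of a local minimum. The total is about `η^(-1/2) * η^(-1) * log(1/ξ)` steps, up to
hidden factors. -/

namespace SaddleNGD

/-! ### Growth of a perturbed linear recursion -/

/-- Each factor satisfies `1 + κ/G ≥ exp (κ/(G + κ))`; the exponents are then summed by
Cauchy-Schwarz in the form `n² / ∑ a_j ≤ ∑ 1/a_j`. Only the sum of the `G j` matters, not their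
individual sizes. -/
lemma exp_le_prod_one_add_div {n : ℕ} {κ : ℝ} (hκ : 0 < κ) {G : ℕ → ℝ} (hG : ∀ i < n, 0 < G i) :
    Real.exp (n ^ 2 * κ / (∑ j ∈ Finset.range n, G j + n * κ)) ≤
      ∏ j ∈ Finset.range n, (1 + κ / G j) := by
  have hterm : ∀ j ∈ Finset.range n, Real.exp (κ / (G j + κ)) ≤ 1 + κ / G j := by
    intro j hj
    have hGj := hG j (Finset.mem_range.1 hj)
    have h := Real.add_one_le_exp (-(κ / (G j + κ)))
    have h2 : -(κ / (G j + κ)) + 1 = (1 + κ / G j)⁻¹ := by field_simp; ring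
    rw [h2, Real.exp_neg] at h
    exact (inv_le_inv₀ (by positivity) (Real.exp_pos _)).1 h
  refine le_trans ?_ (Finset.prod_le_prod (fun _ _ => (Real.exp_pos _).le) hterm)
  rw [← Real.exp_sum, Real.exp_le_exp]
  have h := Finset.sq_sum_div_le_sum_sq_div (Finset.range n) (fun _ => (1 : ℝ))
    (g := fun j => G j + κ) (fun j hj => add_pos (hG j (Finset.mem_range.1 hj)) hκ)
  simp only [Finset.sum_const, Finset.card_range, nsmul_eq_mul, mul_one, one_pow,
    Finset.sum_add_distrib] at h
  calc _ = κ * (n ^ 2 / (∑ j ∈ Finset.range n, G j + n * κ)) := by ring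
    _ ≤ κ * ∑ j ∈ Finset.range n, 1 / (G j + κ) := by gcongr
    _ = _ := by rw [Finset.mul_sum]; simp [div_eq_mul_inv]

/-- All factors are at least 1, so an error `ε` made at any step costs no more than an error `ε` in
the initial value. The errors together use up at most half of `v 0`. -/
lemma growth_of_perturbed_recursion {n : ℕ} {κ ε : ℝ} (hκ : 0 < κ) (hε : 0 ≤ ε) {v G : ℕ → ℝ}
    (hv : 0 < v 0) (hvG : ∀ i ≤ n, v i ≤ G i) (hn : n * ε ≤ v 0 / 2)
    (hstep : ∀ i < n, (1 + κ / G i) * v i - ε ≤ v (i + 1)) :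
    v 0 / 2 * Real.exp (n ^ 2 * κ / (∑ j ∈ Finset.range n, G j + n * κ)) ≤ v n := by
  -- Positivity of `G` is not assumed: it follows along the induction from `0 < v i ≤ G i`, so no
  -- quotient `κ / G i` is a division by zero.
  have key : ∀ i ≤ n, (∀ j < i, 0 < G j) ∧
      (v 0 - i * ε) * ∏ j ∈ Finset.range i, (1 + κ / G j) ≤ v i := by
    intro i
    induction i with
    | zero => intro _; simp
    | succ i ih =>
      intro hi
      obtain ⟨hG, hvi⟩ := ih (by omega)
      have hone : 1 ≤ ∏ j ∈ Finset.range i, (1 + κ / G j) :=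
        Finset.one_le_prod fun j hj =>
          le_add_of_nonneg_right (div_pos hκ (hG j (Finset.mem_range.1 hj))).le
      have hiε : (i : ℝ) * ε ≤ v 0 / 2 := le_trans (by gcongr; omega) hn
      have hpos : 0 < v i := lt_of_lt_of_le (mul_pos (by linarith) (by linarith)) hvi
      have hGi : 0 < G i := lt_of_lt_of_le hpos (hvG i (by omega))
      refine ⟨fun j hj => ?_, ?_⟩
      · rcases Nat.lt_succ_iff_lt_or_eq.1 hj with h | rfl
        exacts [hG j h, hGi]
      · refine le_trans ?_ (hstep i (by omega))
        have hc : 0 < κ / G i := div_pos hκ hGi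
        rw [Finset.prod_range_succ]
        push_cast
        set p := ∏ j ∈ Finset.range i, (1 + κ / G j)
        have h1 := mul_le_mul_of_nonneg_left hvi (by linarith : 0 ≤ 1 + κ / G i)
        have h2 : ε ≤ ε * (p * (1 + κ / G i)) :=
          le_mul_of_one_le_right hε (one_le_mul_of_one_le_of_one_le hone (by linarith))
        linarith
  obtain ⟨hG, hvn⟩ := key n le_rfl
  refine le_trans ?_ hvn
  exact mul_le_mul (by linarith) (exp_le_prod_one_add_div hκ hG) (Real.exp_pos _).le (by linarith)

variable {d : ℕ} {f : EuclideanSpace ℝ (Fin d) → ℝ}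

/-! ### Gradient and Hessian -/

lemma differentiable_of_contDiff_two (hf : ContDiff ℝ 2 f) : Differentiable ℝ f :=
  hf.differentiable (by norm_num)

lemma contDiff_gradient (hf : ContDiff ℝ 2 f) : ContDiff ℝ 1 (gradient f) :=
  ((InnerProductSpace.toDual ℝ (EuclideanSpace ℝ (Fin d))).symm.contDiff).comp
    (hf.fderiv_right (m := 1) (by norm_num))

lemma hasFDerivAt_gradient (hf : ContDiff ℝ 2 f) (x : EuclideanSpace ℝ (Fin d)) :
    HasFDerivAt (gradient f) (hessian f x) x :=
  ((contDiff_gradient hf).differentiable (by norm_num) x).hasFDerivAt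

lemma hessian_symm (hf : ContDiff ℝ 2 f) (x v w : EuclideanSpace ℝ (Fin d)) :
    inner ℝ (hessian f x v) w = inner ℝ v (hessian f x w) := by
  have key : ∀ v w, inner ℝ (hessian f x v) w = fderiv ℝ (fderiv ℝ f) x v w := by
    intro v w
    have h := ((InnerProductSpace.toDual ℝ (EuclideanSpace ℝ (Fin d))).toContinuousLinearEquiv.toContinuousLinearMap.hasFDerivAt
      (x := gradient f x)).comp x (hasFDerivAt_gradient hf x)
    have h2 : (⇑(InnerProductSpace.toDual ℝ (EuclideanSpace ℝ (Fin d))).toContinuousLinearEquiv.toContinuousLinearMap ∘ gradient f)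
        = fderiv ℝ f := toDual_comp_gradient
    have h3 := h.fderiv
    rw [h2] at h3
    rw [h3]
    simp
  have hs : IsSymmSndFDerivAt ℝ f x :=
    hf.contDiffAt.isSymmSndFDerivAt (by simp)
  rw [key, real_inner_comm, key, hs.eq]

lemma exists_unit_eigenvector_of_lambdaMin_le {γ : ℝ} (hγ : 0 < γ)
    {A : EuclideanSpace ℝ (Fin d) →L[ℝ] EuclideanSpace ℝ (Fin d)} (hA : lambdaMin A ≤ -γ) :
    ∃ (μ : ℝ) (e : EuclideanSpace ℝ (Fin d)), γ ≤ μ ∧ ‖e‖ = 1 ∧ A e = -μ • e := by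
  have hne : {μ : ℝ | Module.End.HasEigenvalue
      (A : Module.End ℝ (EuclideanSpace ℝ (Fin d))) μ}.Nonempty := by
    by_contra h
    rw [Set.not_nonempty_iff_eq_empty] at h
    -- An empty spectrum would give the default infimum 0, which is not below `-γ`.
    rw [lambdaMin, h, Real.sInf_empty] at hA
    linarith
  have hmem : lambdaMin A ∈ _ := hne.csInf_mem (Module.End.finite_hasEigenvalue _)
  obtain ⟨v, hv⟩ := Module.End.HasEigenvalue.exists_hasEigenvector hmem
  have hv0 : ‖v‖ ≠ 0 := norm_ne_zero_iff.2 hv.2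
  have hAv : A v = lambdaMin A • v := hv.apply_eq_smul
  refine ⟨-lambdaMin A, ‖v‖⁻¹ • v, by linarith, ?_, ?_⟩
  · rw [norm_smul, norm_inv, norm_norm, inv_mul_cancel₀ hv0]
  · rw [map_smul, hAv, neg_neg, smul_comm]

/-- The descent lemma, from the mean value inequality on a ball; hence the constant `β` in place of
the sharp `β / 2`. -/
lemma apply_le_of_lipschitz_gradient {β : ℝ} (hβ0 : 0 ≤ β) (hf : ContDiff ℝ 2 f)
    (hβ : ∀ x y, ‖gradient f x - gradient f y‖ ≤ β * ‖x - y‖) (x y : EuclideanSpace ℝ (Fin d)) :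
    f y ≤ f x + inner ℝ (gradient f x) (y - x) + β * ‖y - x‖ ^ 2 := by
  have h := (convex_closedBall x ‖y - x‖).norm_image_sub_le_of_norm_hasFDerivWithin_le'
    (f := f) (f' := fun z => fderiv ℝ f z) (φ := fderiv ℝ f x) (C := β * ‖y - x‖) (x := x) (y := y)
    (fun z _ => (differentiable_of_contDiff_two hf z).hasFDerivAt.hasFDerivWithinAt)
    (fun z hz => by
      rw [← toDual_gradient, ← toDual_gradient, ← map_sub, LinearIsometryEquiv.norm_map]
      refine (hβ z x).trans ?_
      gcongr
      simpa [dist_eq_norm] using hz)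
    (by simp) (by simp [dist_eq_norm])
  have h2 := (abs_le.1 ((Real.norm_eq_abs _).symm.trans_le h)).2
  rw [← inner_gradient_left] at h2
  nlinarith

lemma norm_gradient_sub_le {ρ D : ℝ} (hρ0 : 0 ≤ ρ) (hf : ContDiff ℝ 2 f)
    (hρ : ∀ x y, ‖hessian f x - hessian f y‖ ≤ ρ * ‖x - y‖) {c x y : EuclideanSpace ℝ (Fin d)}
    (hx : ‖x - c‖ ≤ D) (hy : ‖y - c‖ ≤ D) :
    ‖gradient f y - gradient f x - hessian f c (y - x)‖ ≤ ρ * D * ‖y - x‖ :=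
  (convex_closedBall c D).norm_image_sub_le_of_norm_hasFDerivWithin_le'
    (fun z _ => (hasFDerivAt_gradient hf z).hasFDerivWithinAt)
    (fun z hz => (hρ z c).trans (by gcongr; simpa [dist_eq_norm] using hz))
    (by simpa [dist_eq_norm] using hx) (by simpa [dist_eq_norm] using hy)

/-! ### The normalized gradient -/

lemma norm_normalized_le {E : Type*} [NormedAddCommGroup E] [NormedSpace ℝ E] (g : E) :
    ‖‖g‖⁻¹ • g‖ ≤ 1 := by
  rw [norm_smul, norm_inv, norm_norm]
  exact inv_mul_le_one

lemma inner_normalized {E : Type*} [NormedAddCommGroup E] [InnerProductSpace ℝ E] (g : E) :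
    inner ℝ g (‖g‖⁻¹ • g) = ‖g‖ := by
  rcases eq_or_ne g 0 with rfl | hg
  · simp
  · have := norm_ne_zero_iff.2 hg
    rw [real_inner_smul_right, real_inner_self_eq_norm_sq]
    field_simp

lemma norm_smul_add_smul_sq_le {E : Type*} [NormedAddCommGroup E] [NormedSpace ℝ E] {η θ : ℝ}
    {v z : E} (hv : ‖v‖ ≤ 1) :
    ‖-(η • v) + θ • z‖ ^ 2 ≤ 2 * (η ^ 2 + θ ^ 2 * ‖z‖ ^ 2) := by
  have h1 : ‖-(η • v) + θ • z‖ ≤ |η| + |θ| * ‖z‖ := by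
    refine (norm_add_le _ _).trans ?_
    rw [norm_neg, norm_smul, norm_smul, Real.norm_eq_abs, Real.norm_eq_abs]
    have := mul_le_mul_of_nonneg_left hv (abs_nonneg η)
    linarith
  have h2 : ‖-(η • v) + θ • z‖ ^ 2 ≤ (|η| + |θ| * ‖z‖) ^ 2 := by gcongr
  have h3 := sq_nonneg (|η| - |θ| * ‖z‖)
  have h4 := sq_abs η
  have h5 := sq_abs θ
  nlinarith

/-! ### One noise period -/

/-- The point `N` steps after `y`, where `z` is the noise vector of the first step. -/
noncomputable def period (f : EuclideanSpace ℝ (Fin d) → ℝ) (η θ : ℝ) (N : ℕ)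
    (y z : EuclideanSpace ℝ (Fin d)) : EuclideanSpace ℝ (Fin d) :=
  iterate f η θ N y (fun _ => z) N

variable {η θ : ℝ} {N : ℕ}

/-- A shift of time by a multiple of `N` preserves the noise schedule, so the points at period
boundaries form a chain driven by one noise vector per period. -/
lemma iterate_period (x₀ : EuclideanSpace ℝ (Fin d)) (n : ℕ → EuclideanSpace ℝ (Fin d)) (k : ℕ) :
    iterate f η θ N x₀ n (N * (k + 1)) =
      period f η θ N (iterate f η θ N x₀ n (N * k)) (n (N * k)) := by
  have key : ∀ i ≤ N, iterate f η θ N x₀ n (N * k + i) =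
      iterate f η θ N (iterate f η θ N x₀ n (N * k)) (fun _ => n (N * k)) i := by
    intro i
    induction i with
    | zero => intro _; rfl
    | succ i ih =>
      intro hi
      rw [← add_assoc, iterate, iterate, ih (by omega), Nat.mul_add_mod]
      congr 2
      rw [Nat.mod_eq_of_lt hi]
      rcases Nat.eq_zero_or_pos i with rfl | h
      · simp
      · simp [h.ne']
  rw [mul_add, mul_one, key N le_rfl, period]

lemma iterate_const_one (y z : EuclideanSpace ℝ (Fin d)) :
    iterate f η θ N y (fun _ => z) 1 =
      y + (-(η • (‖gradient f y‖⁻¹ • gradient f y)) + θ • z) := by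
  simp [iterate]; abel

lemma iterate_const_succ (y z : EuclideanSpace ℝ (Fin d)) {i : ℕ} (hi : 0 < i) (hiN : i < N) :
    iterate f η θ N y (fun _ => z) (i + 1) = iterate f η θ N y (fun _ => z) i
      - η • (‖gradient f (iterate f η θ N y (fun _ => z) i)‖⁻¹ •
        gradient f (iterate f η θ N y (fun _ => z) i)) := by
  rw [iterate, Nat.mod_eq_of_lt hiN]
  simp [hi.ne']

lemma norm_iterate_const_sub_le (hη : 0 ≤ η) (hθ : 0 ≤ θ) (y z : EuclideanSpace ℝ (Fin d)) {i : ℕ}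
    (hi : i ≤ N) : ‖iterate f η θ N y (fun _ => z) i - y‖ ≤ i * η + θ * ‖z‖ := by
  induction i with
  | zero => simp [iterate]; positivity
  | succ i ih =>
    have hstep : ∀ g : EuclideanSpace ℝ (Fin d), ‖η • (‖g‖⁻¹ • g)‖ ≤ η := fun g => by
      rw [norm_smul, Real.norm_of_nonneg hη]
      exact mul_le_of_le_one_right hη (norm_normalized_le g)
    push_cast
    rcases Nat.eq_zero_or_pos i with rfl | h
    · rw [iterate_const_one, add_sub_cancel_left]
      refine (norm_add_le _ _).trans ?_
      rw [norm_neg, norm_smul θ, Real.norm_of_nonneg hθ]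
      have := hstep (gradient f y)
      simpa using this
    · rw [iterate_const_succ y z h (by omega), sub_right_comm]
      refine (norm_sub_le _ _).trans ?_
      linarith [ih (by omega), hstep (gradient f (iterate f η θ N y (fun _ => z) i))]

/-- A normalized step pairs with the gradient to give `η` times its norm, so the descent lemma,
summed over the period, collects gradient norms to the first power. -/
lemma apply_period_le {β : ℝ} (hβ0 : 0 ≤ β) (hf : ContDiff ℝ 2 f)
    (hβ : ∀ x y, ‖gradient f x - gradient f y‖ ≤ β * ‖x - y‖) (hN : 0 < N)
    (y z : EuclideanSpace ℝ (Fin d)) :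
    f (period f η θ N y z) ≤ f y + θ * inner ℝ (gradient f y) z
      + 2 * β * (N * η ^ 2 + θ ^ 2 * ‖z‖ ^ 2)
      - η * ∑ i ∈ Finset.range N, ‖gradient f (iterate f η θ N y (fun _ => z) i)‖ := by
  have key : ∀ i < N, f (iterate f η θ N y (fun _ => z) (i + 1)) ≤
      f y + θ * inner ℝ (gradient f y) z + 2 * β * ((i + 1 : ℕ) * η ^ 2 + θ ^ 2 * ‖z‖ ^ 2)
      - η * ∑ j ∈ Finset.range (i + 1), ‖gradient f (iterate f η θ N y (fun _ => z) j)‖ := by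
    intro i
    induction i with
    | zero =>
      intro _
      have h := apply_le_of_lipschitz_gradient hβ0 hf hβ y
        (iterate f η θ N y (fun _ => z) 1)
      rw [iterate_const_one, add_sub_cancel_left, inner_add_right, inner_neg_right,
        real_inner_smul_right, inner_normalized, real_inner_smul_right] at h
      have h2 := mul_le_mul_of_nonneg_left
        (norm_smul_add_smul_sq_le (η := η) (θ := θ) (z := z) (norm_normalized_le (gradient f y)))
        hβ0
      rw [zero_add, iterate_const_one, Finset.sum_range_one]
      simp only [iterate]
      push_cast
      linarith
    | succ i ih =>
      intro hi
      have h := apply_le_of_lipschitz_gradient hβ0 hf hβ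
        (iterate f η θ N y (fun _ => z) (i + 1)) (iterate f η θ N y (fun _ => z) (i + 1 + 1))
      rw [iterate_const_succ y z (by omega) hi, sub_sub_cancel_left, inner_neg_right,
        real_inner_smul_right, inner_normalized] at h
      have h2 := norm_smul_add_smul_sq_le (η := η) (θ := 0)
        (z := (0 : EuclideanSpace ℝ (Fin d)))
        (norm_normalized_le (gradient f (iterate f η θ N y (fun _ => z) (i + 1))))
      rw [zero_smul, add_zero] at h2
      have h3 := mul_le_mul_of_nonneg_left h2 hβ0
      rw [iterate_const_succ y z (by omega) hi, Finset.sum_range_succ]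
      have := ih (by omega)
      push_cast at this ⊢
      linarith
  obtain ⟨M, rfl⟩ : ∃ M, N = M + 1 := ⟨N - 1, by omega⟩
  exact key M (by omega)

/-- A unit eigenvector `e` of the Hessian at `y` with eigenvalue `-μ`: effect on the gradient along
`e` of a displacement containing noise. -/
lemma le_abs_inner_gradient_add {μ γ ρ : ℝ} (hγ : 0 < γ) (hμ : γ ≤ μ) (hρ0 : 0 ≤ ρ) (hθ : 0 < θ)
    (hf : ContDiff ℝ 2 f) (hρ : ∀ x y, ‖hessian f x - hessian f y‖ ≤ ρ * ‖x - y‖)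
    {y e v z : EuclideanSpace ℝ (Fin d)} (he : ‖e‖ = 1) (hHe : hessian f y e = -μ • e)
    (hw : ρ * ‖-(η • v) + θ • z‖ ^ 2 ≤ γ * θ / 8)
    (hz : 1 / 4 ≤ |inner ℝ e z - (inner ℝ e (gradient f y) + μ * η * inner ℝ e v) / (μ * θ)|) :
    γ * θ / 8 ≤ |inner ℝ e (gradient f (y + (-(η • v) + θ • z)))| := by
  have hμ0 : 0 < μ := hγ.trans_le hμ
  have hgrad := norm_gradient_sub_le (c := y) (x := y) (y := y + (-(η • v) + θ • z))
    (D := ‖-(η • v) + θ • z‖) hρ0 hf hρ (by simp) (by simp)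
  rw [add_sub_cancel_left] at hgrad
  have herr := (abs_real_inner_le_norm e _).trans (mul_le_mul_of_nonneg_left hgrad (norm_nonneg e))
  rw [he, one_mul, mul_assoc, ← sq, inner_sub_right, inner_sub_right, ← hessian_symm hf,
    hHe, real_inner_smul_left, inner_add_right, inner_neg_right, real_inner_smul_right,
    real_inner_smul_right e z] at herr
  set u := inner ℝ e (gradient f (y + (-(η • v) + θ • z)))
  set t := inner ℝ e z - (inner ℝ e (gradient f y) + μ * η * inner ℝ e v) / (μ * θ) with ht
  have hmain : u - inner ℝ e (gradient f y) - -μ * (-(η * inner ℝ e v) + θ * inner ℝ e z)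
      = u + μ * θ * t := by
    rw [ht]; field_simp; ring
  rw [hmain] at herr
  have h5 : γ * θ * (1 / 4) ≤ |μ * θ * t| := by
    rw [abs_mul, abs_of_pos (mul_pos hμ0 hθ)]
    gcongr
  have h6 : |μ * θ * t| ≤ |u + μ * θ * t| + |u| := by
    have := abs_sub (u + μ * θ * t) u
    rwa [add_sub_cancel_left] at this
  linarith

/-- A unit eigenvector `e` of the Hessian at `y` with eigenvalue `-μ`: near `y`, a step along the
normalized gradient expands the component of the gradient along `e`. -/
lemma le_abs_inner_gradient_sub_normalized {μ γ ρ D : ℝ} (hγ : 0 < γ) (hμ : γ ≤ μ) (hρ0 : 0 ≤ ρ)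
    (hη : 0 < η) (hf : ContDiff ℝ 2 f) (hρ : ∀ x y, ‖hessian f x - hessian f y‖ ≤ ρ * ‖x - y‖)
    {y e x x' : EuclideanSpace ℝ (Fin d)} (he : ‖e‖ = 1) (hHe : hessian f y e = -μ • e)
    (hx' : x' = x - η • (‖gradient f x‖⁻¹ • gradient f x)) (hD : ‖x - y‖ ≤ D)
    (hD' : ‖x' - y‖ ≤ D) :
    (1 + η * γ / ‖gradient f x‖) * |inner ℝ e (gradient f x)| - η * ρ * D ≤
      |inner ℝ e (gradient f x')| := by
  have hD0 : 0 ≤ D := (norm_nonneg _).trans hD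
  have hμ0 : 0 < μ := hγ.trans_le hμ
  have hgrad := norm_gradient_sub_le hρ0 hf hρ hD hD'
  have hXi : x' - x = -(η • (‖gradient f x‖⁻¹ • gradient f x)) := by
    rw [hx', sub_sub_cancel_left]
  have hnorm : ‖x' - x‖ ≤ η := by
    rw [hXi, norm_neg, norm_smul, Real.norm_of_nonneg hη.le]
    exact mul_le_of_le_one_right hη.le (norm_normalized_le _)
  have herr := (abs_real_inner_le_norm e _).trans (mul_le_mul_of_nonneg_left
    (hgrad.trans (mul_le_mul_of_nonneg_left hnorm (by positivity))) (norm_nonneg e))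
  rw [he, one_mul, inner_sub_right, inner_sub_right, ← hessian_symm hf, hHe,
    real_inner_smul_left, hXi, inner_neg_right, real_inner_smul_right,
    real_inner_smul_right] at herr
  set u := inner ℝ e (gradient f x)
  set u' := inner ℝ e (gradient f x')
  set G := ‖gradient f x‖ with hGdef
  have hG : 0 ≤ G := norm_nonneg _
  have h1 : (1 + η * γ / G) * |u| ≤ |(1 + η * μ / G) * u| := by
    rw [abs_mul, abs_of_nonneg (a := 1 + η * μ / G) (by positivity)]
    gcongr
  have h3 : |(1 + η * μ / G) * u| ≤ |u'| + |u' - u - -μ * -(η * (G⁻¹ * u))| := by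
    have := abs_sub u' (u' - u - -μ * -(η * (G⁻¹ * u)))
    refine le_trans (le_of_eq ?_) this
    congr 1
    ring
  linarith

/-- Starting near a strict saddle, the gradients seen in one noise period are not all small, unless
the component of the noise along the direction of negative curvature falls into a short interval. -/
lemma le_sum_norm_gradient_of_lambdaMin_le {γ ρ Q S σ : ℝ} (hγ : 0 < γ) (hρ0 : 0 ≤ ρ)
    (hf : ContDiff ℝ 2 f) (hρ : ∀ x y, ‖hessian f x - hessian f y‖ ≤ ρ * ‖x - y‖)
    (hσ : 0 < σ) (hησ : η = σ ^ 2) (hθ : θ = η * Q) (hQ : 1 ≤ Q) (hQρ : 96 * ρ ≤ γ * Q)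
    (hQd : 4 * Q ^ 2 * η * d ≤ 1) (hη : η ≤ 1 / 16) (hℓ : 2 ≤ Real.log (1 / η))
    (hN1 : 1 ≤ N * σ) (hN2 : N * σ ≤ 2) (hS0 : 0 < S)
    (hS : S * (8 * Real.log (1 / η)) ≤ γ) (hσS : 2 * γ * σ ≤ S)
    (y : EuclideanSpace ℝ (Fin d)) (hy : lambdaMin (hessian f y) ≤ -γ) :
    ∃ (e : EuclideanSpace ℝ (Fin d)) (a : ℝ), ‖e‖ = 1 ∧ ∀ z, ‖z‖ ^ 2 ≤ 4 * d →
      1 / 4 ≤ |inner ℝ e z - a| →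
        S ≤ ∑ i ∈ Finset.range N, ‖gradient f (iterate f η θ N y (fun _ => z) i)‖ := by
  obtain ⟨μ, e, hμ, he, hHe⟩ := exists_unit_eigenvector_of_lambdaMin_le hγ hy
  have hη0 : 0 < η := by rw [hησ]; positivity
  have hθ0 : 0 < θ := by rw [hθ]; positivity
  have hμ0 : 0 < μ := hγ.trans_le hμ
  have hinner : ∀ v : EuclideanSpace ℝ (Fin d), |inner ℝ e v| ≤ ‖v‖ := fun v => by
    simpa [he] using abs_real_inner_le_norm e v
  have hσ4 : σ ≤ 1 / 4 := by nlinarith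
  have hN4 : 4 ≤ N := by
    have : (4 : ℝ) ≤ N := by
      by_contra h
      push Not at h
      nlinarith
    exact_mod_cast this
  set g0 := gradient f y with hg0
  -- The witness is the value of `⟪e, z⟫` at which the linearized gradient after the noisy step has
  -- no component along `e`.
  refine ⟨e, (inner ℝ e g0 + μ * η * inner ℝ e (‖g0‖⁻¹ • g0)) / (μ * θ), he, fun z hz hza => ?_⟩
  set X := iterate f η θ N y (fun _ => z) with hX
  have hθz : θ * ‖z‖ ≤ σ := by
    refine abs_le_of_sq_le_sq' ?_ hσ.le |>.2
    calc (θ * ‖z‖) ^ 2 = θ ^ 2 * ‖z‖ ^ 2 := by ring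
      _ ≤ θ ^ 2 * (4 * d) := by gcongr
      _ = η * (4 * Q ^ 2 * η * d) := by rw [hθ]; ring
      _ ≤ η * 1 := by gcongr
      _ = σ ^ 2 := by rw [hησ, mul_one]
  -- The steps contribute at most `N η ≤ 2 σ`, the noise at most `σ`.
  have hD : ∀ i ≤ N, ‖X i - y‖ ≤ 3 * σ := fun i hi => by
    refine (norm_iterate_const_sub_le hη0.le hθ0.le y z hi).trans ?_
    have h1 : (i : ℝ) * η ≤ N * η := by gcongr
    have h2 : N * η = (N * σ) * σ := by rw [hησ]; ring
    nlinarith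
  have hρθ : 96 * ρ * η ≤ γ * θ := by
    rw [hθ]
    have := mul_le_mul_of_nonneg_right hQρ hη0.le
    linarith
  -- the component along `e` after the noisy step
  have hfirst : γ * θ / 8 ≤ |inner ℝ e (gradient f (X 1))| := by
    rw [hX, iterate_const_one]
    refine le_abs_inner_gradient_add hγ hμ hρ0 hθ0 hf hρ he hHe ?_ hza
    have hw2 : ‖-(η • (‖g0‖⁻¹ • g0)) + θ • z‖ ^ 2 ≤ 2 * (η ^ 2 + θ ^ 2 * ‖z‖ ^ 2) :=
      norm_smul_add_smul_sq_le (norm_normalized_le g0)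
    have h1 : θ ^ 2 * ‖z‖ ^ 2 ≤ η := by
      have := pow_le_pow_left₀ (by positivity) hθz 2
      rw [hησ]; linarith [mul_pow θ ‖z‖ 2]
    have h2 : ρ * ‖-(η • (‖g0‖⁻¹ • g0)) + θ • z‖ ^ 2 ≤ ρ * (2 * (η * (1 / 16) + η)) := by
      gcongr
      refine hw2.trans ?_
      rw [sq η]
      gcongr
    linarith [mul_nonneg hρ0 hη0.le]
  -- the growth along `e` in the noiseless steps
  have hstep : ∀ i, 0 < i → i < N →
      (1 + η * γ / ‖gradient f (X i)‖) * |inner ℝ e (gradient f (X i))| - η * ρ * (3 * σ) ≤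
        |inner ℝ e (gradient f (X (i + 1)))| := by
    intro i h0 hi
    exact le_abs_inner_gradient_sub_normalized hγ hμ hρ0 hη0 hf hρ he hHe
      (iterate_const_succ y z h0 hi) (hD i hi.le) (hD (i + 1) hi)
  -- if all gradients were small, the last one would be large
  by_contra hlt
  push Not at hlt
  -- The growth runs from `X 1`, just after the noise, to `X (N - 1)`, the last point whose gradient
  -- is counted in the sum.
  set n := N - 2 with hn
  have hnN : (n : ℝ) = N - 2 := by rw [hn]; push_cast [Nat.cast_sub (by omega : 2 ≤ N)]; ring
  have hN4' : (4 : ℝ) ≤ N := by exact_mod_cast hN4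
  have hnσ : (n : ℝ) * σ = N * σ - 2 * σ := by rw [hnN]; ring
  have hnσ2 : (n : ℝ) * σ ≤ 2 := by linarith
  have hgrow := growth_of_perturbed_recursion (n := n) (κ := η * γ) (ε := η * ρ * (3 * σ))
    (by positivity) (by positivity) (v := fun i => |inner ℝ e (gradient f (X (i + 1)))|)
    (G := fun i => ‖gradient f (X (i + 1))‖)
    (lt_of_lt_of_le (by positivity) hfirst) (fun i _ => hinner _)
    (by
      -- This is half of `γ θ / 8` at most, by `96 ρ η ≤ γ θ`; the constant 96 originates here.
      have h1 : n * (η * ρ * (3 * σ)) ≤ 6 * η * ρ := by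
        have := mul_le_mul_of_nonneg_left hnσ2 (by positivity : 0 ≤ 3 * η * ρ)
        linarith
      simp only [zero_add]
      linarith)
    (fun i hi => hstep (i + 1) (by omega) (by omega))
  simp only [zero_add] at hgrow
  have hsub : ∑ j ∈ Finset.range n, ‖gradient f (X (j + 1))‖ ≤ S := by
    refine le_trans ?_ hlt.le
    have h1 := Finset.sum_range_succ' (fun j => ‖gradient f (X j)‖) n
    have h2 : ∑ j ∈ Finset.range (n + 1), ‖gradient f (X j)‖ ≤
        ∑ j ∈ Finset.range N, ‖gradient f (X j)‖ :=
      Finset.sum_le_sum_of_subset_of_nonneg (Finset.range_subset_range.2 (by omega))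
        fun _ _ _ => norm_nonneg _
    linarith [norm_nonneg (gradient f (X 0))]
  have hlast : ‖gradient f (X (n + 1))‖ < S :=
    lt_of_le_of_lt (Finset.single_le_sum (f := fun j => ‖gradient f (X j)‖)
      (fun _ _ => norm_nonneg _) (Finset.mem_range.2 (by omega))) hlt
  -- Here `n² η ≥ 1/4` and the denominator is at most `2 S`, so the exponent is at least `γ / (8 S)
  -- ≥ log (1/η)`.
  have hexp : 1 / η ≤ Real.exp (n ^ 2 * (η * γ) /
      (∑ j ∈ Finset.range n, ‖gradient f (X (j + 1))‖ + n * (η * γ))) := by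
    rw [← Real.log_le_iff_le_exp (by positivity)]
    have hnκ : n * (η * γ) ≤ S := by
      refine le_trans ?_ hσS
      have := mul_le_mul_of_nonneg_right hnσ2 (by positivity : 0 ≤ σ * γ)
      rw [hησ]; linarith
    have hden : 0 < ∑ j ∈ Finset.range n, ‖gradient f (X (j + 1))‖ + n * (η * γ) := by
      have hn0 : (0 : ℝ) < n := by linarith
      exact add_pos_of_nonneg_of_pos (Finset.sum_nonneg fun _ _ => norm_nonneg _) (by positivity)
    rw [le_div_iff₀ hden]
    have h1 : 1 / 4 ≤ (n : ℝ) ^ 2 * η := by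
      have : 1 / 2 ≤ (n : ℝ) * σ := by linarith
      rw [hησ, ← mul_pow]
      calc (1 / 4 : ℝ) = (1 / 2) ^ 2 := by norm_num
        _ ≤ _ := by gcongr
    have h2 := mul_le_mul_of_nonneg_left (add_le_add hsub hnκ) (by linarith : 0 ≤ Real.log (1 / η))
    have h3 := mul_le_mul_of_nonneg_right h1 hγ.le
    linarith
  -- The last gradient has norm at least `γ Q / 16 ≥ γ / 16`, whereas it is below `S ≤ γ / 16`.
  have hfinal := (mul_le_mul (by linarith : γ * θ / 8 / 2 ≤ _) hexp (by positivity)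
    (by positivity)).trans (hgrow.trans (hinner _))
  have h1 : γ * θ / 8 / 2 * (1 / η) = γ * Q / 16 := by rw [hθ]; field_simp; norm_num
  rw [h1] at hfinal
  have h2 := mul_le_mul_of_nonneg_left hQ hγ.le
  have h3 := mul_le_mul_of_nonneg_left hℓ hS0.le
  linarith

end SaddleNGD

namespace SaddleNGD

variable {d : ℕ}

/-! ### The standard Gaussian -/

lemma map_inner_stdGaussian {e : EuclideanSpace ℝ (Fin d)} (he : ‖e‖ = 1) :
    (stdGaussian (EuclideanSpace ℝ (Fin d))).map (fun z => inner ℝ e z) = gaussianReal 0 1 := by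
  have h := IsGaussian.map_eq_gaussianReal (μ := stdGaussian (EuclideanSpace ℝ (Fin d)))
    (innerSL ℝ e)
  rw [integral_strongDual_stdGaussian, variance_dual_stdGaussian, innerSL_apply_norm, he] at h
  simpa using h

lemma integral_norm_sq_stdGaussian :
    ∫ z, ‖z‖ ^ 2 ∂(stdGaussian (EuclideanSpace ℝ (Fin d))) = d := by
  have hi : ∀ i : Fin d, Integrable (fun z : EuclideanSpace ℝ (Fin d) => z i ^ 2)
      (stdGaussian (EuclideanSpace ℝ (Fin d))) := fun i =>
    (IsGaussian.memLp_dual _ (EuclideanSpace.proj (𝕜 := ℝ) i) 2 (by norm_num)).integrable_sq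
  simp_rw [EuclideanSpace.real_norm_sq_eq]
  rw [integral_finsetSum _ fun i _ => hi i]
  have h1 : ∀ i : Fin d, ∫ z : EuclideanSpace ℝ (Fin d), z i ^ 2
      ∂(stdGaussian (EuclideanSpace ℝ (Fin d))) = 1 := fun i => by
    have h := variance_dual_stdGaussian (innerSL ℝ (EuclideanSpace.single i (1 : ℝ)))
    rw [variance_of_integral_eq_zero (by fun_prop) (integral_strongDual_stdGaussian _),
      innerSL_apply_norm] at h
    simpa [EuclideanSpace.inner_single_left] using h
  simp [h1]

lemma integrable_norm_sq_stdGaussian :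
    Integrable (fun z => ‖z‖ ^ 2) (stdGaussian (EuclideanSpace ℝ (Fin d))) :=
  (IsGaussian.memLp_two_id (μ := stdGaussian (EuclideanSpace ℝ (Fin d)))).norm.integrable_sq

/-- The density is at most 1/2 and the interval has length 1/2. -/
lemma gaussianReal_abs_sub_lt_le (a : ℝ) :
    (gaussianReal 0 1).real {x | |x - a| < 1 / 4} ≤ 1 / 4 := by
  have hset : {x : ℝ | |x - a| < 1 / 4} = Metric.ball a (1 / 4) := by
    ext x; simp [Real.dist_eq]
  rw [hset, measureReal_def, gaussianReal_apply_eq_integral 0 one_ne_zero,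
    ENNReal.toReal_ofReal (integral_nonneg fun _ => gaussianPDFReal_nonneg _ _ _)]
  have hpdf : ∀ x, gaussianPDFReal 0 1 x ≤ 1 / 2 := fun x => by
    rw [gaussianPDFReal]
    have h1 : (2 : ℝ) ≤ √(2 * Real.pi * (1 : NNReal)) := by
      apply Real.le_sqrt_of_sq_le
      have := Real.pi_gt_three
      push_cast
      linarith
    have h2 : Real.exp (-(x - 0) ^ 2 / (2 * (1 : NNReal))) ≤ 1 := by
      rw [Real.exp_le_one_iff]
      have := sq_nonneg x
      simp only [sub_zero, NNReal.coe_one, mul_one]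
      linarith
    calc _ ≤ (2 : ℝ)⁻¹ * 1 := by gcongr
      _ = 1 / 2 := by norm_num
  calc ∫ x in Metric.ball a (1 / 4), gaussianPDFReal 0 1 x
      ≤ ∫ x in Metric.ball a (1 / 4), (1 / 2 : ℝ) :=
        integral_mono (integrable_gaussianPDFReal 0 1).integrableOn
          (integrableOn_const measure_ball_lt_top.ne) hpdf
    _ = 1 / 4 := by
      rw [setIntegral_const, measureReal_def, Real.volume_ball]
      norm_num

lemma measurableSet_norm_sq_le_inter (e : EuclideanSpace ℝ (Fin d)) (a : ℝ) :
    MeasurableSet ({z : EuclideanSpace ℝ (Fin d) | ‖z‖ ^ 2 ≤ 4 * d} ∩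
      {z | 1 / 4 ≤ |inner ℝ e z - a|}) :=
  (measurableSet_le (by fun_prop) (by fun_prop)).inter
    (measurableSet_le (by fun_prop) (by fun_prop))

/-- Markov's inequality for `‖z‖²`, of mean `d`, and the density bound along `e` each exclude
probability at most 1/4. -/
lemma half_le_stdGaussian_good (e : EuclideanSpace ℝ (Fin d)) (he : ‖e‖ = 1) (hd : 0 < d) (a : ℝ) :
    1 / 2 ≤ (stdGaussian (EuclideanSpace ℝ (Fin d))).real
      ({z | ‖z‖ ^ 2 ≤ 4 * d} ∩ {z | 1 / 4 ≤ |inner ℝ e z - a|}) := by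
  set P := stdGaussian (EuclideanSpace ℝ (Fin d))
  have hd' : (0 : ℝ) < d := by exact_mod_cast hd
  have h1 : P.real {z | 4 * (d : ℝ) ≤ ‖z‖ ^ 2} ≤ 1 / 4 := by
    have := mul_meas_ge_le_integral_of_nonneg (μ := P)
      (Filter.Eventually.of_forall fun z => sq_nonneg ‖z‖) integrable_norm_sq_stdGaussian (4 * d)
    rw [integral_norm_sq_stdGaussian] at this
    nlinarith
  have h2 : P.real {z | |inner ℝ e z - a| < 1 / 4} ≤ 1 / 4 := by
    have := gaussianReal_abs_sub_lt_le a
    rw [← map_inner_stdGaussian he, map_measureReal_apply (by fun_prop)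
      (measurableSet_lt (by fun_prop) (by fun_prop))] at this
    exact this
  have h3 : P.real ({z | ‖z‖ ^ 2 ≤ 4 * d} ∩ {z | 1 / 4 ≤ |inner ℝ e z - a|})ᶜ ≤ 1 / 4 + 1 / 4 := by
    refine (measureReal_mono ?_).trans ((measureReal_union_le _ _).trans (add_le_add h1 h2))
    intro z hz
    by_cases h : ‖z‖ ^ 2 ≤ 4 * d
    · exact Or.inr (not_le.1 (fun h' => hz ⟨h, h'⟩) : |inner ℝ e z - a| < 1 / 4)
    · exact Or.inl (not_le.1 h).le
  rw [probReal_compl_eq_one_sub (measurableSet_norm_sq_le_inter e a)] at h3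
  linarith

/-! ### Measurability of the iterates -/

variable {f : EuclideanSpace ℝ (Fin d) → ℝ} {η θ : ℝ} {N : ℕ}

lemma measurable_gradient (hf : ContDiff ℝ 2 f) : Measurable (gradient f) :=
  (contDiff_gradient hf).continuous.measurable

lemma measurable_iterate {Ω : Type*} {m : MeasurableSpace Ω} (hf : ContDiff ℝ 2 f)
    {x₀ : Ω → EuclideanSpace ℝ (Fin d)} (hx₀ : Measurable x₀)
    {n : ℕ → Ω → EuclideanSpace ℝ (Fin d)} {t : ℕ} (hn : ∀ i < t, Measurable (n i)) :
    Measurable fun ω => iterate f η θ N (x₀ ω) (fun i => n i ω) t := by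
  induction t with
  | zero => exact hx₀
  | succ t ih =>
    have hX := ih fun i hi => hn i (by omega)
    have hg := (measurable_gradient hf).comp hX
    simp only [iterate]
    refine (hX.sub ((hg.norm.inv.smul hg).const_smul η)).add (Measurable.const_smul ?_ θ)
    split_ifs
    exacts [hn t (by omega), measurable_const]

lemma measurable_period (hf : ContDiff ℝ 2 f) :
    Measurable fun q : EuclideanSpace ℝ (Fin d) × EuclideanSpace ℝ (Fin d) =>
      period f η θ N q.1 q.2 :=
  measurable_iterate hf measurable_fst fun _ _ => measurable_snd

/-- In expectation, one noise period that starts at a point with a large gradient or with strongly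
negative curvature decreases the objective. -/
lemma integral_apply_period_le {γ β ρ B Q S σ : ℝ} (hd : 0 < d) (hγ : 0 < γ) (hβ0 : 0 ≤ β)
    (hρ0 : 0 ≤ ρ) (hf : ContDiff ℝ 2 f)
    (hβ : ∀ x y, ‖gradient f x - gradient f y‖ ≤ β * ‖x - y‖)
    (hρ : ∀ x y, ‖hessian f x - hessian f y‖ ≤ ρ * ‖x - y‖) (hB : ∀ x, |f x| ≤ B)
    (hσ : 0 < σ) (hησ : η = σ ^ 2) (hθ : θ = η * Q) (hQ : 1 ≤ Q) (hQρ : 96 * ρ ≤ γ * Q)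
    (hQd : 4 * Q ^ 2 * η * d ≤ 1) (hη : η ≤ 1 / 16) (hℓ : 2 ≤ Real.log (1 / η))
    (hN1 : 1 ≤ N * σ) (hN2 : N * σ ≤ 2) (hS0 : 0 < S)
    (hS : S * (8 * Real.log (1 / η)) ≤ γ) (hσS : 2 * γ * σ ≤ S)
    (hnoise : 2 * β * (N * η ^ 2 + θ ^ 2 * d) ≤ η * S / 4)
    (y : EuclideanSpace ℝ (Fin d)) (hy : S ≤ ‖gradient f y‖ ∨ lambdaMin (hessian f y) ≤ -γ) :
    ∫ z, f (period f η θ N y z) ∂(stdGaussian (EuclideanSpace ℝ (Fin d))) ≤ f y - η * S / 4 := by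
  set P := stdGaussian (EuclideanSpace ℝ (Fin d))
  have hη0 : 0 < η := by rw [hησ]; positivity
  have hN : 0 < N := by
    rcases Nat.eq_zero_or_pos N with rfl | h
    · norm_num at hN1
    · exact h
  obtain ⟨A, hAm, hA2, hA⟩ : ∃ A : Set (EuclideanSpace ℝ (Fin d)), MeasurableSet A ∧
      1 / 2 ≤ P.real A ∧ ∀ z ∈ A,
        S ≤ ∑ i ∈ Finset.range N, ‖gradient f (iterate f η θ N y (fun _ => z) i)‖ := by
    rcases hy with hy | hy
    · refine ⟨Set.univ, MeasurableSet.univ, by rw [probReal_univ]; norm_num, fun z _ => ?_⟩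
      have h := Finset.single_le_sum
        (f := fun i => ‖gradient f (iterate f η θ N y (fun _ => z) i)‖)
        (fun _ _ => norm_nonneg _) (Finset.mem_range.2 hN)
      rw [iterate] at h
      exact hy.trans h
    · obtain ⟨e, a, he, h⟩ := le_sum_norm_gradient_of_lambdaMin_le hγ hρ0 hf hρ hσ hησ hθ hQ hQρ
        hQd hη hℓ hN1 hN2 hS0 hS hσS y hy
      refine ⟨{z | ‖z‖ ^ 2 ≤ 4 * d} ∩ {z | 1 / 4 ≤ |inner ℝ e z - a|},
        measurableSet_norm_sq_le_inter e a, half_le_stdGaussian_good e he hd a, fun z hz => ?_⟩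
      exact h z hz.1 hz.2
  have hmeas : Measurable fun z => f (period f η θ N y z) :=
    hf.continuous.measurable.comp ((measurable_period hf).comp measurable_prodMk_left)
  have hint : Integrable (fun z => f (period f η θ N y z)) P :=
    Integrable.of_bound hmeas.aestronglyMeasurable B (Filter.Eventually.of_forall fun z => hB _)
  have hlin : Integrable (fun z => inner ℝ (gradient f y) z) P :=
    IsGaussian.integrable_dual P (innerSL ℝ (gradient f y))
  have hlin0 : ∫ z, inner ℝ (gradient f y) z ∂P = 0 :=
    integral_strongDual_stdGaussian (innerSL ℝ (gradient f y))
  have hsq : Integrable (fun z => ‖z‖ ^ 2) P := integrable_norm_sq_stdGaussian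
  have hind : Integrable (A.indicator fun _ => η * S) P := (integrable_const _).indicator hAm
  -- The bound is kept on the whole space, with gain 0 off `A`, because the linear noise term
  -- averages to zero only there and not over `A`.
  have hmono : ∀ z, f (period f η θ N y z) ≤ (f y + 2 * β * (N * η ^ 2))
      + θ * inner ℝ (gradient f y) z + 2 * β * θ ^ 2 * ‖z‖ ^ 2 - A.indicator (fun _ => η * S) z := by
    intro z
    have h := apply_period_le (η := η) (θ := θ) hβ0 hf hβ hN y z
    have h2 : A.indicator (fun _ => η * S) z ≤
        η * ∑ i ∈ Finset.range N, ‖gradient f (iterate f η θ N y (fun _ => z) i)‖ := by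
      by_cases hz : z ∈ A
      · rw [Set.indicator_of_mem hz]
        exact mul_le_mul_of_nonneg_left (hA z hz) hη0.le
      · rw [Set.indicator_of_notMem hz]
        exact mul_nonneg hη0.le (Finset.sum_nonneg fun _ _ => norm_nonneg _)
    linarith
  have h1 : Integrable (fun z => (f y + 2 * β * (N * η ^ 2)) + θ * inner ℝ (gradient f y) z) P :=
    (integrable_const _).add (hlin.const_mul θ)
  have h2 : Integrable (fun z => (f y + 2 * β * (N * η ^ 2)) + θ * inner ℝ (gradient f y) z
      + 2 * β * θ ^ 2 * ‖z‖ ^ 2) P := h1.add (hsq.const_mul _)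
  have h := integral_mono hint (h2.sub hind) hmono
  rw [integral_sub' h2 hind, integral_add h1 (hsq.const_mul _),
    integral_add (integrable_const _) (hlin.const_mul θ), integral_const_mul, integral_const_mul,
    hlin0, integral_norm_sq_stdGaussian, integral_indicator_const _ hAm, integral_const,
    probReal_univ, smul_eq_mul, smul_eq_mul] at h
  have h3 := mul_le_mul_of_nonneg_right hA2 (by positivity : 0 ≤ η * S)
  linarith

end SaddleNGD

namespace SaddleNGD

/-! ### Survival probability of a chain whose potential decreases in expectation -/

/-- Over `m` further steps the potential loses at least `m δ` times the final survival probability,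
but it had at most `C` times the initial one to lose. -/
lemma le_half_pow_of_potential {a p : ℕ → ℝ} {C δ : ℝ} (hδ : 0 < δ) (hp : Antitone p)
    (hp0 : ∀ k, 0 ≤ p k) (ha : ∀ k, 0 ≤ a k) (haC : ∀ k, a k ≤ C * p k)
    (hstep : ∀ k, a (k + 1) ≤ a k - δ * p (k + 1)) {m : ℕ} (hm0 : 0 < m)
    (hm : 2 * C ≤ m * δ) (L : ℕ) : p (m * L) ≤ (1 / 2) ^ L * p 0 := by
  have hsum : ∀ j i, a (j + i) + i * δ * p (j + i) ≤ a j := by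
    intro j i
    induction i with
    | zero => simp
    | succ i ih =>
      have h1 := hstep (j + i)
      have h2 := mul_le_mul_of_nonneg_left (hp (Nat.le_succ (j + i))) (by positivity : 0 ≤ i * δ)
      rw [← add_assoc]
      push_cast
      linarith
  induction L with
  | zero => simp
  | succ L ih =>
    have h1 := hsum (m * L) m
    have h2 := haC (m * L)
    have h3 := ha (m * L + m)
    have h4 := mul_le_mul_of_nonneg_right hm (hp0 (m * L))
    have hmδ : 0 < m * δ := by positivity
    have h5 : p (m * L + m) ≤ 1 / 2 * p (m * L) := by
      refine le_of_mul_le_mul_left ?_ hmδ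
      linarith
    rw [mul_add, mul_one, pow_succ]
    linarith

/-- The state is frozen and the independent noise integrated out by Fubini, instead of through a
conditional expectation. -/
lemma setIntegral_comp_le_of_indep {Ω E : Type*} {m mΩ : MeasurableSpace Ω} [MeasurableSpace E]
    {P : Measure Ω} [IsProbabilityMeasure P] (hm : m ≤ mΩ) {Y Z : Ω → E}
    (hY : Measurable[m] Y) (hZ : Measurable Z) (hind : Indep m (MeasurableSpace.comap Z ‹_›) P)
    {F : E × E → E} (hF : Measurable F) {f : E → ℝ} (hf : Measurable f) {B δ : ℝ}
    (hB : ∀ x, |f x| ≤ B) {A : Set Ω} (hA : MeasurableSet[m] A)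
    (hdec : ∀ ω ∈ A, ∫ z, f (F (Y ω, z)) ∂(P.map Z) ≤ f (Y ω) - δ) :
    ∫ ω in A, f (F (Y ω, Z ω)) ∂P ≤ ∫ ω in A, (f (Y ω) - δ) ∂P := by
  have hAm : MeasurableSet A := hm _ hA
  have hYm : Measurable Y := hY.mono hm le_rfl
  -- `A` need not be determined by `Y`, so its indicator is carried as an extra coordinate of the
  -- state.
  set s : Ω → ℝ := A.indicator fun _ => 1 with hs
  have hsm : Measurable[m] s := Measurable.indicator measurable_const hA
  have hΦ : Measurable[m] fun ω => (Y ω, s ω) := Measurable.prodMk hY hsm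
  have hΦm : Measurable fun ω => (Y ω, s ω) := hΦ.mono hm le_rfl
  have hΦZ : IndepFun (fun ω => (Y ω, s ω)) Z P :=
    indep_of_indep_of_le_left hind hΦ.comap_le
  have hmap := (indepFun_iff_map_prod_eq_prod_map_map hΦm.aemeasurable hZ.aemeasurable).1 hΦZ
  have := Measure.isProbabilityMeasure_map (μ := P) hZ.aemeasurable
  have := Measure.isProbabilityMeasure_map (μ := P) hΦm.aemeasurable
  set h : (E × ℝ) × E → ℝ := fun q => q.1.2 * f (F (q.1.1, q.2)) with hh
  have hhm : Measurable h := by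
    refine (measurable_snd.comp measurable_fst).mul (hf.comp (hF.comp ?_))
    exact (measurable_fst.comp measurable_fst).prodMk measurable_snd
  have hpair : Measurable fun ω => ((Y ω, s ω), Z ω) := hΦm.prodMk hZ
  have hfF : Integrable (fun ω => f (F (Y ω, Z ω))) P :=
    Integrable.of_bound (hf.comp (hF.comp (hYm.prodMk hZ))).aestronglyMeasurable B
      (Filter.Eventually.of_forall fun _ => hB _)
  have hcomp : (fun ω => h ((Y ω, s ω), Z ω)) = A.indicator fun ω => f (F (Y ω, Z ω)) := by
    ext ω
    by_cases hω : ω ∈ A <;> simp [hh, hs, hω]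
  have hint : Integrable h ((P.map fun ω => (Y ω, s ω)).prod (P.map Z)) := by
    rw [← hmap, integrable_map_measure hhm.aestronglyMeasurable hpair.aemeasurable]
    change Integrable (fun ω => h ((Y ω, s ω), Z ω)) P
    rw [hcomp]
    exact hfF.indicator hAm
  have hinner : Measurable fun ω => ∫ z, f (F (Y ω, z)) ∂(P.map Z) :=
    ((hf.comp hF).stronglyMeasurable.integral_prod_right' (ν := P.map Z)).measurable.comp hYm
  have hinnerB : ∀ ω, ‖∫ z, f (F (Y ω, z)) ∂(P.map Z)‖ ≤ B := fun ω => by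
    have := norm_integral_le_of_norm_le_const (μ := P.map Z) (f := fun z => f (F (Y ω, z)))
      (C := B) (Filter.Eventually.of_forall fun z => hB _)
    simpa using this
  calc ∫ ω in A, f (F (Y ω, Z ω)) ∂P
      = ∫ ω, h ((Y ω, s ω), Z ω) ∂P := by rw [hcomp, integral_indicator hAm]
    _ = ∫ q, h q ∂(P.map fun ω => ((Y ω, s ω), Z ω)) :=
        (integral_map hpair.aemeasurable hhm.aestronglyMeasurable).symm
    _ = ∫ x, ∫ z, h (x, z) ∂(P.map Z) ∂(P.map fun ω => (Y ω, s ω)) := by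
        rw [hmap, integral_prod _ hint]
    _ = ∫ ω, ∫ z, h ((Y ω, s ω), z) ∂(P.map Z) ∂P :=
        integral_map hΦm.aemeasurable
          (hhm.stronglyMeasurable.integral_prod_right' (ν := P.map Z)).aestronglyMeasurable
    _ = ∫ ω in A, ∫ z, f (F (Y ω, z)) ∂(P.map Z) ∂P := by
        rw [← integral_indicator hAm]
        congr 1
        ext ω
        by_cases hω : ω ∈ A <;> simp [hh, hs, hω]
    _ ≤ ∫ ω in A, (f (Y ω) - δ) ∂P := by
        refine setIntegral_mono_on (Integrable.of_bound hinner.aestronglyMeasurable B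
          (Filter.Eventually.of_forall hinnerB)).integrableOn ?_ hAm hdec
        exact ((Integrable.of_bound (hf.comp hYm).aestronglyMeasurable B
          (Filter.Eventually.of_forall fun _ => hB _)).sub (integrable_const δ)).integrableOn

/-- A chain driven by independent noise, whose potential decreases by `δ` in expectation as long as
it stays in `W`, leaves `W` quickly with high probability. -/
lemma measureReal_forall_mem_le {Ω E : Type*} {mΩ : MeasurableSpace Ω} [MeasurableSpace E]
    {P : Measure Ω} [IsProbabilityMeasure P] {m : ℕ → MeasurableSpace Ω} (hm : ∀ k, m k ≤ mΩ)
    (hmono : Monotone m) {Y Z : ℕ → Ω → E} (hY : ∀ k, Measurable[m k] (Y k))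
    (hZ : ∀ k, Measurable (Z k))
    (hind : ∀ k, Indep (m k) (MeasurableSpace.comap (Z k) ‹_›) P)
    {ν : Measure E} (hν : ∀ k, P.map (Z k) = ν)
    {F : E × E → E} (hF : Measurable F) (hYF : ∀ k ω, Y (k + 1) ω = F (Y k ω, Z k ω))
    {f : E → ℝ} (hf : Measurable f) {B δ : ℝ} (hδ : 0 < δ) (hB : ∀ x, |f x| ≤ B)
    {W : Set E} (hW : MeasurableSet W) (hdec : ∀ y ∈ W, ∫ z, f (F (y, z)) ∂ν ≤ f y - δ)
    {M : ℕ} (hM0 : 0 < M) (hM : 4 * B ≤ M * δ) (L : ℕ) :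
    P.real {ω | ∀ j < M * L, Y j ω ∈ W} ≤ (1 / 2) ^ L := by
  set A : ℕ → Set Ω := fun k => {ω | ∀ j < k, Y j ω ∈ W} with hAdef
  have hA_anti : Antitone A := fun i j hij ω hω l hl => hω l (hl.trans_le hij)
  have hA : ∀ k, MeasurableSet[m k] (A (k + 1)) := fun k => by
    have : A (k + 1) = ⋂ j ∈ Finset.range (k + 1), Y j ⁻¹' W := by
      ext ω; simp [hAdef]
    rw [this]
    exact Finset.measurableSet_biInter _ fun j hj =>
      (hY j).mono (hmono (Nat.lt_succ_iff.1 (Finset.mem_range.1 hj))) le_rfl hW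
  have hA_meas : ∀ k, MeasurableSet (A k) := fun k => by
    cases k with
    | zero => simp [hAdef]
    | succ k => exact hm k _ (hA k)
  have hfY : ∀ k, Integrable (fun ω => f (Y k ω)) P := fun k =>
    Integrable.of_bound (hf.comp ((hY k).mono (hm k) le_rfl)).aestronglyMeasurable B
      (Filter.Eventually.of_forall fun _ => hB _)
  have hfYB : ∀ k, Integrable (fun ω => f (Y k ω) + B) P := fun k =>
    (hfY k).add (integrable_const B)
  have h0 : ∀ k ω, 0 ≤ f (Y k ω) + B := fun k ω => by linarith [(abs_le.1 (hB (Y k ω))).1]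
  have hA0 : P.real (A 0) = 1 := by simp [hAdef]
  -- The potential is the shifted objective on the survival event. The decrease is weighted by `A (k
  -- + 1)`, the event that knows `Y k ∈ W`.
  have hmain := le_half_pow_of_potential (a := fun k => ∫ ω in A k, (f (Y k ω) + B) ∂P)
    (p := fun k => P.real (A k)) (C := 2 * B) hδ
    (fun i j hij => measureReal_mono (hA_anti hij)) (fun _ => measureReal_nonneg)
    (fun k => setIntegral_nonneg (hA_meas k) fun ω _ => h0 k ω)
    (fun k => by
      have : ∫ ω in A k, (f (Y k ω) + B) ∂P ≤ ∫ ω in A k, 2 * B ∂P :=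
        setIntegral_mono_on (hfYB k).integrableOn (integrable_const _).integrableOn (hA_meas k)
          fun ω _ => by linarith [(abs_le.1 (hB (Y k ω))).2]
      rw [setIntegral_const, smul_eq_mul] at this
      linarith)
    (fun k => by
      have h1 := setIntegral_comp_le_of_indep (hm k) (hY k) (hZ k) (hind k) hF hf (δ := δ) hB (hA k)
        (fun ω hω => by rw [hν]; exact hdec _ (hω k (Nat.lt_succ_self k)))
      simp_rw [← hYF] at h1
      rw [integral_sub (hfY k).integrableOn (integrable_const _).integrableOn, setIntegral_const,
        smul_eq_mul] at h1
      have h2 : ∫ ω in A (k + 1), (f (Y k ω) + B) ∂P ≤ ∫ ω in A k, (f (Y k ω) + B) ∂P :=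
        setIntegral_mono_set (hfYB k).integrableOn (Filter.Eventually.of_forall (h0 k))
          (hA_anti (Nat.le_succ k)).eventuallyLE
      rw [integral_add (hfY k).integrableOn (integrable_const _).integrableOn] at h2
      have h3 := integral_add (μ := P.restrict (A (k + 1))) (hfY (k + 1)).integrableOn
        (integrable_const B)
      linarith)
    hM0 (by linarith) L
  simpa [hA0] using hmain

end SaddleNGD

/-! ### From expected decrease per period to reaching a local minimum -/

namespace SaddleNGD

/-- If every noise period that starts at a point with a large gradient or with strongly negative
curvature decreases the objective by `δ` in expectation, then the iterates come close to a local
minimum. -/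
lemma le_measureReal_reachesLocalMin {p : Params} {f : p.E → ℝ} (hf : Objective p f)
    {η θ S δ : ℝ} {N T M L : ℕ} (hS : S ≤ p.ν) (hδ : 0 < δ)
    (hdec : ∀ y, (S ≤ ‖gradient f y‖ ∨ lambdaMin (hessian f y) ≤ -p.γ) →
      ∫ z, f (period f η θ N y z) ∂(stdGaussian p.E) ≤ f y - δ)
    (hM0 : 0 < M) (hM : 4 * p.B ≤ M * δ) (hT : N * (M * L) ≤ T)
    (x₀ : p.E) {Ω : Type*} [MeasurableSpace Ω] (P : Measure Ω) [IsProbabilityMeasure P]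
    {n : ℕ → Ω → p.E} (hn : IsGaussianNoise P n) :
    1 - (1 / 2) ^ L ≤
      P.real {ω | ReachesLocalMin f p.r T (iterate f η θ N x₀ (fun t => n t ω))} := by
  have hae : ∀ t, AEMeasurable (n t) P := fun t => (hn.2 t).aemeasurable
  -- `HasLaw` gives only almost everywhere measurability; measurable versions are needed to generate
  -- the filtration.
  set n' : ℕ → Ω → p.E := fun t => (hae t).mk with hn'
  have hn'm : ∀ t, Measurable (n' t) := fun t => (hae t).measurable_mk
  have hnn' : ∀ t, n t =ᵐ[P] n' t := fun t => (hae t).ae_eq_mk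
  have hind : iIndepFun n' P := hn.1.congr hnn'
  set m : ℕ → MeasurableSpace Ω := fun k =>
    ⨆ i ∈ {i | i < N * k}, MeasurableSpace.comap (n' i) inferInstance with hmdef
  have hn'le : ∀ i, MeasurableSpace.comap (n' i) inferInstance ≤ ‹MeasurableSpace Ω› :=
    fun i => (hn'm i).comap_le
  have hm : ∀ k, m k ≤ ‹MeasurableSpace Ω› := fun k => iSup₂_le fun i _ => hn'le i
  have hmono : Monotone m := fun k l hkl => biSup_mono fun i hi =>
    lt_of_lt_of_le (show i < N * k from hi) (Nat.mul_le_mul_left N hkl)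
  have hfm : Measurable f := hf.contDiff.continuous.measurable
  -- The region is defined by the decrease itself, so that the measurability of `lambdaMin` plays no
  -- role.
  have hW : MeasurableSet {y | ∫ z, f (period f η θ N y z) ∂(stdGaussian p.E) ≤ f y - δ} := by
    refine measurableSet_le ?_ (hfm.sub_const δ)
    exact ((hfm.comp (measurable_period hf.contDiff)).stronglyMeasurable.integral_prod_right'
      (ν := stdGaussian p.E)).measurable
  have hsurv := measureReal_forall_mem_le (P := P) hm hmono
    (Y := fun k ω => iterate f η θ N x₀ (fun t => n' t ω) (N * k))
    (Z := fun k => n' (N * k))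
    (fun k => measurable_iterate hf.contDiff measurable_const fun i hi =>
      Measurable.mono (comap_measurable (n' i)) (le_iSup₂_of_le i hi le_rfl) le_rfl)
    (fun k => hn'm _)
    (fun k => by
      have h := indep_iSup_of_disjoint hn'le hind.iIndep
        (S := {i | i < N * k}) (T := {N * k}) (by simp)
      rwa [iSup_singleton] at h)
    (ν := stdGaussian p.E)
    (fun k => by rw [← Measure.map_congr (hnn' _), (hn.2 _).map_eq])
    (measurable_period hf.contDiff) (fun k ω => iterate_period _ _ k)
    hfm hδ hf.bounded hW (fun y hy => hy) hM0 hM L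
  set A := {ω | ∀ j < M * L, iterate f η θ N x₀ (fun t => n' t ω) (N * j) ∈
    {y | ∫ z, f (period f η θ N y z) ∂(stdGaussian p.E) ≤ f y - δ}} with hA
  have hAm : MeasurableSet A := by
    have : A = ⋂ j ∈ Finset.range (M * L),
        (fun ω => iterate f η θ N x₀ (fun t => n' t ω) (N * j)) ⁻¹'
          {y | ∫ z, f (period f η θ N y z) ∂(stdGaussian p.E) ≤ f y - δ} := by
      ext ω; simp [hA]
    rw [this]
    exact Finset.measurableSet_biInter _ fun j _ =>
      measurable_iterate hf.contDiff measurable_const (fun i _ => hn'm i) hW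
  have hcompl := probReal_compl_eq_one_sub (μ := P) hAm
  refine le_trans (by linarith : 1 - (1 / 2 : ℝ) ^ L ≤ P.real Aᶜ) ?_
  refine ENNReal.toReal_mono (measure_ne_top _ _) (measure_mono_ae ?_)
  filter_upwards [ae_all_iff.2 hnn'] with ω hω hmem
  obtain ⟨j, hj, hjW⟩ : ∃ j < M * L, ¬ ∫ z, f (period f η θ N
      (iterate f η θ N x₀ (fun t => n' t ω) (N * j)) z) ∂(stdGaussian p.E) ≤
        f (iterate f η θ N x₀ (fun t => n' t ω) (N * j)) - δ := by
    by_contra! h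
    exact hmem h
  have hseq : (fun t => n' t ω) = fun t => n t ω := funext fun t => (hω t).symm
  rw [hseq] at hjW
  refine ⟨N * j, (Nat.mul_le_mul_left N hj.le).trans hT, ?_⟩
  have hnot := fun h => hjW (hdec _ h)
  rcases hf.strictSaddle (iterate f η θ N x₀ (fun t => n t ω) (N * j)) with h | h | ⟨xs, h1, h2, _⟩
  · exact (hnot (Or.inl (hS.trans h))).elim
  · exact (hnot (Or.inr h)).elim
  · exact ⟨xs, h1, h2⟩

end SaddleNGD

namespace SaddleNGD

/-! ### Bounds by the hidden quantity -/

lemma two_le_add_inv {c : ℝ} (hc : 0 < c) : 2 ≤ c + c⁻¹ := by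
  have h : c * c⁻¹ = 1 := mul_inv_cancel₀ hc.ne'
  have := inv_pos.2 hc
  nlinarith [sq_nonneg (c - c⁻¹)]

namespace Params

variable (p : Params)

lemma one_le_d : (1 : ℝ) ≤ p.d := by exact_mod_cast p.d_pos

lemma log_d_nonneg : 0 ≤ Real.log p.d := Real.log_nonneg p.one_le_d

lemma log_inv_ξ_nonneg : 0 ≤ Real.log (1 / p.ξ) :=
  Real.log_nonneg (by rw [le_div_iff₀ p.ξ_pos]; linarith [p.ξ_lt_one])

/-- Everything that is hidden is bounded by `hidden`. -/
lemma hidden_bounds : 15 ≤ p.hidden ∧ p.γ ≤ p.hidden ∧ p.γ⁻¹ ≤ p.hidden ∧ p.ν⁻¹ ≤ p.hidden ∧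
    p.r⁻¹ ≤ p.hidden ∧ p.β ≤ p.hidden ∧ p.ρ ≤ p.hidden ∧ p.B ≤ p.hidden ∧
    Real.log p.d ≤ p.hidden ∧ Real.log (1 / p.ξ) ≤ p.hidden := by
  have h1 := two_le_add_inv p.α_pos
  have h2 := two_le_add_inv p.γ_pos
  have h3 := two_le_add_inv p.ν_pos
  have h4 := two_le_add_inv p.r_pos
  have h5 := two_le_add_inv p.β_pos
  have h6 := two_le_add_inv p.ρ_pos
  have h7 := two_le_add_inv p.B_pos
  have h8 := p.log_d_nonneg
  have h9 := p.log_inv_ξ_nonneg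
  have i2 := inv_pos.2 p.γ_pos
  have i3 := p.ν_pos
  have i4 := p.r_pos
  have i5 := inv_pos.2 p.β_pos
  have i6 := inv_pos.2 p.ρ_pos
  have i7 := inv_pos.2 p.B_pos
  have i8 := p.γ_pos
  unfold hidden
  refine ⟨?_, ?_, ?_, ?_, ?_, ?_, ?_, ?_, ?_, ?_⟩ <;> linarith

lemma one_le_hidden : 1 ≤ p.hidden := by linarith [p.hidden_bounds.1]

/-- The noise level in units of the learning rate. -/
noncomputable def noiseFactor : ℝ := 96 * p.ρ / p.γ + 1

lemma one_le_noiseFactor : 1 ≤ p.noiseFactor := by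
  have := p.ρ_pos
  have := p.γ_pos
  exact le_add_of_nonneg_left (by positivity)

lemma noiseFactor_le : p.noiseFactor ≤ 97 * p.hidden ^ 2 := by
  obtain ⟨-, -, h1, -, -, -, h2, -⟩ := p.hidden_bounds
  have h3 := one_le_pow₀ (n := 2) p.one_le_hidden
  have h4 := mul_le_mul h2 h1 (inv_pos.2 p.γ_pos).le (by linarith [p.one_le_hidden])
  rw [noiseFactor, div_eq_mul_inv]
  nlinarith

/-- A lower bound for the sum of the gradient norms over a successful noise period. -/
noncomputable def gradientMass (η : ℝ) : ℝ := min p.ν (p.γ / (8 * Real.log (1 / η)))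

end Params

lemma two_le_log_one_div {η : ℝ} (hη0 : 0 < η) (hη : η ≤ 1 / 16) : 2 ≤ Real.log (1 / η) := by
  rw [Real.le_log_iff_exp_le (by positivity), le_div_iff₀ hη0]
  have h1 : Real.exp 2 = Real.exp 1 ^ 2 := by rw [← Real.exp_nat_mul]; norm_num
  have h2 : Real.exp 2 ≤ 16 := by
    rw [h1]
    have := Real.exp_one_lt_d9
    have := Real.exp_pos 1
    nlinarith
  nlinarith

/-- Lets a fourth root of the learning rate absorb the logarithm in `gradientMass`. -/
lemma log_one_div_mul_sqrt_sqrt_le {η : ℝ} (hη0 : 0 < η) : Real.log (1 / η) * √√η ≤ 4 := by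
  set ζ := √√η with hζ
  have hζ0 : 0 < ζ := by positivity
  have h1 : η = ζ ^ 4 := by
    rw [show (4 : ℕ) = 2 * 2 from rfl, pow_mul, Real.sq_sqrt (by positivity),
      Real.sq_sqrt hη0.le]
  have h2 : Real.log (1 / η) = 4 * Real.log (1 / ζ) := by
    rw [h1, ← one_div_pow, Real.log_pow]; norm_num
  have h3 : Real.log (1 / ζ) ≤ 1 / ζ := Real.log_le_self (by positivity)
  rw [h2]
  calc 4 * Real.log (1 / ζ) * ζ ≤ 4 * (1 / ζ) * ζ := by gcongr
    _ = 4 := by field_simp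

/-- For a small learning rate, all requirements on the parameters of a noise period are met. -/
lemma Params.period_conditions (p : Params) {η : ℝ} (hη0 : 0 < η)
    (hη : η ≤ 1 / (p.hidden ^ 64 * (p.d : ℝ) ^ 2)) :
    η ≤ 1 / 16 ∧ 4 * p.noiseFactor ^ 2 * η * p.d ≤ 1 ∧ 0 < p.gradientMass η ∧
      2 * p.γ * √η ≤ p.gradientMass η ∧
      8 * p.β * (2 * √η + p.noiseFactor ^ 2 * η * p.d) ≤ p.gradientMass η := by
  obtain ⟨hH, hγ, hγ', hν, -, hβ, -⟩ := p.hidden_bounds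
  have hQ := p.noiseFactor_le
  have hQ1 := p.one_le_noiseFactor
  have hd := p.one_le_d
  have hγ0 := p.γ_pos
  have hν0 := p.ν_pos
  have hβ0 := p.β_pos
  set H := p.hidden
  set Q := p.noiseFactor
  set D : ℝ := (p.d : ℝ)
  have hH0 : 0 < H := by linarith
  have hH1 : 1 ≤ H := by linarith
  set ζ := √√η with hζ
  set σ := √η with hσ
  have hζ0 : 0 < ζ := by positivity
  have hσζ : σ = ζ ^ 2 := (Real.sq_sqrt (by positivity)).symm
  have hησ : η = σ ^ 2 := (Real.sq_sqrt hη0.le).symm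
  have hσ0 : 0 < σ := by positivity
  have hσD : σ * D ≤ 1 / H ^ 32 := by
    have : σ ≤ 1 / (H ^ 32 * D) := by
      refine abs_le_of_sq_le_sq' ?_ (by positivity) |>.2
      rw [← hησ]
      refine hη.trans (le_of_eq ?_)
      rw [one_div_pow, mul_pow, ← pow_mul]
    calc σ * D ≤ 1 / (H ^ 32 * D) * D := by gcongr
      _ = 1 / H ^ 32 := by field_simp
  have hσH : σ ≤ 1 / H ^ 32 := le_trans (le_mul_of_one_le_right hσ0.le hd) hσD
  have hζH : ζ ≤ 1 / H ^ 16 := by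
    refine abs_le_of_sq_le_sq' ?_ (by positivity) |>.2
    rw [← hσζ, one_div_pow, ← pow_mul]
    exact hσH
  have hζ3 : ζ * 768 * H ^ 2 ≤ 1 := by
    have h1 : (768 : ℝ) ≤ H ^ 14 := by
      calc (768 : ℝ) ≤ 15 ^ 14 := by norm_num
        _ ≤ H ^ 14 := by gcongr
    calc ζ * 768 * H ^ 2 ≤ 1 / H ^ 16 * H ^ 14 * H ^ 2 := by gcongr
      _ = 1 := by field_simp
  have hζ1 : ζ ≤ 1 := by
    refine hζH.trans ?_
    rw [div_le_one (by positivity)]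
    exact one_le_pow₀ hH1
  have hQ4 : Q ≤ H ^ 4 := by
    have : (97 : ℝ) ≤ H ^ 2 := by nlinarith
    calc Q ≤ 97 * H ^ 2 := hQ
      _ ≤ H ^ 2 * H ^ 2 := by gcongr
      _ = H ^ 4 := by ring
  have hQσ : 4 * Q ^ 2 * (σ * D) ≤ 1 := by
    have h1 : (4 : ℝ) ≤ H ^ 24 := by
      calc (4 : ℝ) ≤ 15 ^ 24 := by norm_num
        _ ≤ H ^ 24 := by gcongr
    calc 4 * Q ^ 2 * (σ * D) ≤ H ^ 24 * (H ^ 4) ^ 2 * (1 / H ^ 32) := by gcongr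
      _ = 1 := by field_simp
  have hσ16 : σ ≤ 1 / 16 := by
    refine hσH.trans ?_
    have h1 : (16 : ℝ) ≤ H ^ 32 := by
      calc (16 : ℝ) ≤ 15 ^ 32 := by norm_num
        _ ≤ H ^ 32 := by gcongr
    gcongr
  have hη16 : η ≤ 1 / 16 := by
    rw [hησ]
    nlinarith
  have hℓ2 := two_le_log_one_div hη0 hη16
  have hℓζ := log_one_div_mul_sqrt_sqrt_le hη0
  rw [← hσ, ← hζ] at hℓζ
  set ℓ := Real.log (1 / η)
  -- With `ζ = η^(1/4)`, the mass is at least of order `ζ / H`, while the terms to be dominated are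
  -- at most `24 H ζ²`. The power 64 in the threshold gives `ζ ≤ H^(-16)`, which is ample.
  have hS : ζ / (32 * H) ≤ p.gradientMass η := by
    refine le_min ?_ ?_
    · have : 1 / H ≤ p.ν := by
        rw [one_div, inv_le_comm₀ hH0 hν0]
        exact hν
      refine le_trans ?_ this
      gcongr
      linarith
    · have : 1 / H ≤ p.γ := by
        rw [one_div, inv_le_comm₀ hH0 hγ0]
        exact hγ'
      calc ζ / (32 * H) = 1 / H * (ζ / 32) := by field_simp
        _ ≤ p.γ * (1 / (8 * ℓ)) := by
          gcongr ?_ * ?_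
          rw [div_le_div_iff₀ (by norm_num) (by positivity)]
          linarith
        _ = p.γ / (8 * ℓ) := by ring
  have hsmall : 24 * H * σ ≤ ζ / (32 * H) := by
    rw [le_div_iff₀ (by positivity), hσζ]
    have := mul_le_mul_of_nonneg_left hζ3 hζ0.le
    nlinarith
  refine ⟨hη16, ?_, lt_of_lt_of_le (by positivity) hS, ?_, ?_⟩
  · calc 4 * Q ^ 2 * η * D = (4 * Q ^ 2 * (σ * D)) * σ := by rw [hησ]; ring
      _ ≤ 1 * 1 := by gcongr; linarith
      _ = 1 := by norm_num
  · refine le_trans ?_ (hsmall.trans hS)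
    have : p.γ * σ ≤ H * σ := by gcongr
    have : 0 ≤ H * σ := by positivity
    linarith
  · refine le_trans ?_ (hsmall.trans hS)
    have h1 : Q ^ 2 * η * D ≤ σ := by
      have := mul_le_mul_of_nonneg_right hQσ hσ0.le
      have h0 : 0 ≤ Q ^ 2 * (σ * D) * σ := by positivity
      have : Q ^ 2 * η * D = Q ^ 2 * (σ * D) * σ := by rw [hησ]; ring
      linarith
    calc 8 * p.β * (2 * σ + Q ^ 2 * η * D) ≤ 8 * H * (2 * σ + σ) := by gcongr
      _ = 24 * H * σ := by ring

/-! ### The schedule -/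

namespace Params

variable (p : Params)

/-- The length of a noise period. -/
noncomputable def periodLength (η : ℝ) : ℕ := ⌈1 / √η⌉₊

/-- The number of noise periods in which the failure probability is halved. -/
noncomputable def halvingPeriods (η : ℝ) : ℕ := ⌈16 * p.B / (η * p.gradientMass η)⌉₊

/-- The number of halvings of the failure probability. -/
noncomputable def halvings : ℕ := ⌈Real.log (1 / p.ξ) / Real.log 2⌉₊

/-- The total number of steps. -/
noncomputable def totalSteps (η : ℝ) : ℕ :=
  periodLength η * (p.halvingPeriods η * p.halvings)

lemma periodLength_bounds {η : ℝ} (hη0 : 0 < η) (hη : η ≤ 1) :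
    1 / √η ≤ periodLength η ∧ periodLength η ≤ 2 / √η := by
  have h0 : 0 < √η := by positivity
  have h1 : 1 ≤ 1 / √η := by
    rw [le_div_iff₀ h0, one_mul]
    exact Real.sqrt_le_one.2 hη
  refine ⟨Nat.le_ceil _, ?_⟩
  have h2 := Nat.ceil_lt_add_one (by positivity : 0 ≤ 1 / √η)
  have h3 : 2 / √η = 1 / √η + 1 / √η := by ring
  rw [periodLength, h3]
  linarith

lemma half_pow_halvings_le : (1 / 2 : ℝ) ^ p.halvings ≤ p.ξ := by
  have h2 : 0 < Real.log 2 := Real.log_pos (by norm_num)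
  have h := Nat.le_ceil (Real.log (1 / p.ξ) / Real.log 2)
  rw [div_le_iff₀ h2, ← Real.log_pow, Real.log_le_log_iff (by simpa using p.ξ_pos) (by positivity),
    div_le_iff₀ p.ξ_pos] at h
  rw [one_div_pow, div_le_iff₀ (by positivity), mul_comm]
  exact h

lemma halvings_le : (p.halvings : ℝ) ≤ 3 * p.hidden := by
  have h2 : 1 / 2 ≤ Real.log 2 := by linarith [Real.log_two_gt_d9]
  have h := Nat.ceil_lt_add_one (div_nonneg p.log_inv_ξ_nonneg (by linarith : 0 ≤ Real.log 2))
  have h3 : Real.log (1 / p.ξ) / Real.log 2 ≤ 2 * p.hidden := by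
    rw [div_le_iff₀ (by linarith)]
    have h4 := p.hidden_bounds.2.2.2.2.2.2.2.2.2
    have h5 := mul_le_mul_of_nonneg_left h2 (by linarith [p.one_le_hidden] : 0 ≤ 2 * p.hidden)
    linarith
  rw [halvings]
  linarith [p.one_le_hidden]

/-- With the right schedule, the iterates come close to a local minimum with probability at least
`1 - ξ`. -/
lemma le_measureReal_reachesLocalMin_totalSteps {p : Params} {η : ℝ} (hη0 : 0 < η)
    (hη : η ≤ 1 / (p.hidden ^ 64 * (p.d : ℝ) ^ 2)) {f : p.E → ℝ} (hf : Objective p f) (x₀ : p.E)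
    {Ω : Type*} [MeasurableSpace Ω] (P : Measure Ω) [IsProbabilityMeasure P]
    {n : ℕ → Ω → p.E} (hn : IsGaussianNoise P n) :
    1 - p.ξ ≤ P.real {ω | ReachesLocalMin f p.r (p.totalSteps η)
      (iterate f η (η * p.noiseFactor) (periodLength η) x₀ (fun t => n t ω))} := by
  obtain ⟨hη16, hQd, hS0, hσS, hnoise⟩ := p.period_conditions hη0 hη
  obtain ⟨hN1, hN2⟩ := periodLength_bounds hη0 (by linarith)
  have hℓ := two_le_log_one_div hη0 hη16
  have hγ := p.γ_pos
  have hβ := p.β_pos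
  have hB := p.B_pos
  have hσ0 : 0 < √η := by positivity
  have hησ : η = √η ^ 2 := (Real.sq_sqrt hη0.le).symm
  rw [div_le_iff₀ hσ0] at hN1
  rw [le_div_iff₀ hσ0] at hN2
  refine le_trans (sub_le_sub_left p.half_pow_halvings_le 1) (le_measureReal_reachesLocalMin hf
    (S := p.gradientMass η) (δ := η * p.gradientMass η / 4) (M := p.halvingPeriods η)
    (L := p.halvings) (min_le_left _ _) (by positivity) (fun y hy => ?_)
    (Nat.ceil_pos.2 (by positivity)) ?_ le_rfl x₀ P hn)
  · refine integral_apply_period_le p.d_pos hγ hβ.le p.ρ_pos.le hf.contDiff hf.smooth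
      hf.lipschitzHessian hf.bounded hσ0 hησ rfl p.one_le_noiseFactor ?_ hQd hη16 hℓ hN1 hN2 hS0 ?_
      hσS ?_ y hy
    · rw [Params.noiseFactor]
      have : p.γ * (96 * p.ρ / p.γ + 1) = 96 * p.ρ + p.γ := by field_simp
      linarith
    · calc p.gradientMass η * (8 * Real.log (1 / η))
          ≤ p.γ / (8 * Real.log (1 / η)) * (8 * Real.log (1 / η)) :=
            mul_le_mul_of_nonneg_right (min_le_right _ _) (by positivity)
        _ = p.γ := by field_simp
    · have h1 : periodLength η * η ≤ 2 * √η := by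
        have := mul_le_mul_of_nonneg_right hN2 hσ0.le
        rwa [mul_assoc, ← sq, ← hησ] at this
      calc 2 * p.β * (periodLength η * η ^ 2 + (η * p.noiseFactor) ^ 2 * p.d)
          = η / 4 * (8 * p.β * (periodLength η * η + p.noiseFactor ^ 2 * η * p.d)) := by ring
        _ ≤ η / 4 * (8 * p.β * (2 * √η + p.noiseFactor ^ 2 * η * p.d)) := by gcongr
        _ ≤ η / 4 * p.gradientMass η := by gcongr
        _ = η * p.gradientMass η / 4 := by ring
  · have h := Nat.le_ceil (16 * p.B / (η * p.gradientMass η))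
    rw [div_le_iff₀ (by positivity)] at h
    rw [halvingPeriods]
    linarith

/-- The logarithm of a power of `d` is a hidden factor, since `hidden` contains `log d`. -/
lemma log_one_div_le {η C : ℝ} {k : ℕ} (hη0 : 0 < η) (hC : 0 < C)
    (h : 1 / η ≤ C * p.hidden ^ k * (p.d : ℝ) ^ 2) :
    Real.log (1 / η) ≤ (|Real.log C| + k + 2) * p.hidden := by
  have hH := p.one_le_hidden
  have hH0 : 0 < p.hidden := by linarith
  have hd : (0 : ℝ) < p.d := by linarith [p.one_le_d]
  have h1 := Real.log_le_log (by positivity) h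
  rw [Real.log_mul (by positivity) (by positivity), Real.log_mul (by positivity) (by positivity),
    Real.log_pow, Real.log_pow] at h1
  have h2 := Real.log_le_self hH0.le
  have h3 := p.hidden_bounds.2.2.2.2.2.2.2.2.1
  have h4 : Real.log C ≤ |Real.log C| * p.hidden :=
    (le_abs_self _).trans (le_mul_of_one_le_right (abs_nonneg _) hH)
  have h5 : k * Real.log p.hidden ≤ k * p.hidden := by gcongr
  push_cast at h1
  linarith

lemma totalSteps_le {η C : ℝ} {k : ℕ} (hη0 : 0 < η)
    (hη : η ≤ 1 / (p.hidden ^ 64 * (p.d : ℝ) ^ 2)) (hC : 1 ≤ C)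
    (h : 1 / η ≤ C * p.hidden ^ k * (p.d : ℝ) ^ 2) :
    (p.totalSteps η : ℝ) ≤
      6 * (16 * (1 + 8 * (|Real.log C| + k + 2)) + 1) * C ^ 2 * p.hidden ^ (2 * k + 4)
        * (p.d : ℝ) ^ 3 := by
  obtain ⟨hη16, -, hS0, -, -⟩ := p.period_conditions hη0 hη
  obtain ⟨hH15, -, hγ', hν, -, -, -, hB, -⟩ := p.hidden_bounds
  have hN := (periodLength_bounds hη0 (by linarith)).2
  have hL := p.halvings_le
  have hlog := p.log_one_div_le hη0 (by linarith) h
  have hℓ := two_le_log_one_div hη0 hη16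
  have hγ0 := p.γ_pos
  have hν0 := p.ν_pos
  have hB0 := p.B_pos
  have hd := p.one_le_d
  have hM := Nat.ceil_lt_add_one (by positivity : 0 ≤ 16 * p.B / (η * p.gradientMass η))
  set c := |Real.log C| + k + 2 with hc
  have hc0 : 0 < c := by positivity
  set H := p.hidden
  set D : ℝ := (p.d : ℝ)
  have hH1 : 1 ≤ H := by linarith
  have hS : (p.gradientMass η)⁻¹ ≤ (1 + 8 * c) * H ^ 2 := by
    rcases min_choice p.ν (p.γ / (8 * Real.log (1 / η))) with h1 | h1
    · rw [gradientMass, h1]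
      refine hν.trans ?_
      nlinarith [mul_pos hc0 (by positivity : 0 < H ^ 2)]
    · rw [gradientMass, h1, inv_div, div_eq_mul_inv]
      calc 8 * Real.log (1 / η) * p.γ⁻¹ ≤ 8 * (c * H) * H := by gcongr
        _ ≤ (1 + 8 * c) * H ^ 2 := by nlinarith
  have hM' : (p.halvingPeriods η : ℝ) ≤ (16 * (1 + 8 * c) + 1) * H ^ 3 * (1 / η) := by
    have h1 : 16 * p.B / (η * p.gradientMass η) ≤ 16 * (1 + 8 * c) * H ^ 3 * (1 / η) := by
      calc 16 * p.B / (η * p.gradientMass η)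
          = 16 * p.B * (p.gradientMass η)⁻¹ * (1 / η) := by field_simp
        _ ≤ 16 * H * ((1 + 8 * c) * H ^ 2) * (1 / η) := by gcongr
        _ = 16 * (1 + 8 * c) * H ^ 3 * (1 / η) := by ring
    have h2 : 1 ≤ H ^ 3 * (1 / η) := by
      refine one_le_mul_of_one_le_of_one_le (one_le_pow₀ hH1) ?_
      rw [le_div_iff₀ hη0]
      linarith
    rw [halvingPeriods]
    linarith
  have hroot : 1 / √η ≤ C * H ^ k * D := by
    refine abs_le_of_sq_le_sq' ?_ (by positivity) |>.2
    rw [one_div_pow, Real.sq_sqrt hη0.le]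
    refine h.trans ?_
    have h1 : 1 ≤ C * H ^ k := one_le_mul_of_one_le_of_one_le hC (one_le_pow₀ hH1)
    calc C * H ^ k * D ^ 2 ≤ C * H ^ k * (C * H ^ k) * D ^ 2 := by
          refine mul_le_mul_of_nonneg_right ?_ (by positivity)
          exact le_mul_of_one_le_right (by positivity) h1
      _ = (C * H ^ k * D) ^ 2 := by ring
  calc (p.totalSteps η : ℝ)
      = periodLength η * (p.halvingPeriods η * p.halvings) := by
        rw [totalSteps]; push_cast; ring
    _ ≤ 2 / √η * ((16 * (1 + 8 * c) + 1) * H ^ 3 * (1 / η) * (3 * H)) := by gcongr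
    _ = 6 * (16 * (1 + 8 * c) + 1) * H ^ 4 * ((1 / √η) * (1 / η)) := by ring
    _ ≤ 6 * (16 * (1 + 8 * c) + 1) * H ^ 4 * ((C * H ^ k * D) * (C * H ^ k * D ^ 2)) := by gcongr
    _ = _ := by ring

end Params

/-! ### Soft-O bookkeeping and the main theorem -/

lemma exists_learningRate_lower_bound {ηmax s : Params → ℝ}
    (hηmax : SoftO (fun p => 1 / (p.d : ℝ) ^ 2) ηmax) (hs : SoftO (fun p => p.r ^ 2) s) :
    ∃ (C : ℝ) (k : ℕ), 1 ≤ C ∧ ∀ p : Params, 0 < min (ηmax p) (s p) ∧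
      1 / min (ηmax p) (s p) ≤ C * p.hidden ^ k * (p.d : ℝ) ^ 2 := by
  obtain ⟨C₁, k₁, hC₁, h₁⟩ := hηmax
  obtain ⟨C₂, k₂, hC₂, h₂⟩ := hs
  refine ⟨C₁ + C₂ + 1, k₁ + (k₂ + 2), by linarith, fun p => ?_⟩
  have hH := p.one_le_hidden
  have hH0 : 0 < p.hidden := by linarith
  have hd := p.one_le_d
  have hr := p.r_pos
  have hrH := p.hidden_bounds.2.2.2.2.1
  have hη0 : 0 < ηmax p :=
    pos_of_mul_pos_right (lt_of_lt_of_le (by positivity) (h₁ p)) (by positivity)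
  have hs0 : 0 < s p :=
    pos_of_mul_pos_right (lt_of_lt_of_le (by positivity) (h₂ p)) (by positivity)
  refine ⟨lt_min hη0 hs0, ?_⟩
  have hη1 : 1 / ηmax p ≤ C₁ * p.hidden ^ k₁ * (p.d : ℝ) ^ 2 := by
    have h := h₁ p
    rw [div_le_iff₀ (by positivity)] at h
    rw [div_le_iff₀ hη0]
    linarith
  have hs1 : 1 / s p ≤ C₂ * p.hidden ^ (k₂ + 2) := by
    rw [div_le_iff₀ hs0]
    have h3 : 1 ≤ p.hidden ^ 2 * p.r ^ 2 := by
      rw [← mul_pow]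
      refine one_le_pow₀ ?_
      rwa [inv_le_iff_one_le_mul₀ hr] at hrH
    calc 1 ≤ p.hidden ^ 2 * p.r ^ 2 := h3
      _ ≤ p.hidden ^ 2 * (C₂ * p.hidden ^ k₂ * s p) := by gcongr; exact h₂ p
      _ = _ := by ring
  have hp1 : p.hidden ^ k₁ ≤ p.hidden ^ (k₁ + (k₂ + 2)) := pow_le_pow_right₀ hH (by omega)
  have hp2 : p.hidden ^ (k₂ + 2) ≤ p.hidden ^ (k₁ + (k₂ + 2)) := pow_le_pow_right₀ hH (by omega)
  rcases min_choice (ηmax p) (s p) with h | h <;> rw [h]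
  · refine hη1.trans ?_
    gcongr
    linarith
  · refine hs1.trans ?_
    calc C₂ * p.hidden ^ (k₂ + 2)
        ≤ (C₁ + C₂ + 1) * p.hidden ^ (k₁ + (k₂ + 2)) := by gcongr; linarith
      _ ≤ _ := le_mul_of_one_le_right (by positivity) (one_le_pow₀ hd)

end SaddleNGD

theorem corollary1 :
    ∃ ηbar : SaddleNGD.Params → ℝ,
      SaddleNGD.SoftTheta ηbar (fun p => 1 / (p.d : ℝ) ^ 2) ∧
      ∀ ηmax s : SaddleNGD.Params → ℝ,
        SaddleNGD.SoftTheta ηmax (fun p => 1 / (p.d : ℝ) ^ 2) → (∀ p, ηmax p ≤ ηbar p) →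
        SaddleNGD.SoftTheta s (fun p => p.r ^ 2) →
        ∃ (η θ : SaddleNGD.Params → ℝ) (N₀ T : SaddleNGD.Params → ℕ),
          (∀ p, η p = min (ηmax p) (s p)) ∧
          SaddleNGD.SoftTheta θ η ∧
          SaddleNGD.SoftTheta (fun p => (N₀ p : ℝ)) (fun p => η p ^ (-(1 / 2) : ℝ)) ∧
          SaddleNGD.SoftO (fun p => (T p : ℝ)) (fun p => ηmax p ^ (-(3 / 2) : ℝ)) ∧
          SaddleNGD.SoftO (fun p => (T p : ℝ)) (fun p => (p.d : ℝ) ^ 3) ∧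
          ∀ (p : SaddleNGD.Params) (f : p.E → ℝ), SaddleNGD.Objective p f →
            ∀ (x₀ : p.E) (Ω : Type*) [MeasurableSpace Ω] (P : MeasureTheory.Measure Ω)
              [MeasureTheory.IsProbabilityMeasure P] (n : ℕ → Ω → p.E),
              SaddleNGD.IsGaussianNoise P n →
              1 - p.ξ ≤ P.real {ω | SaddleNGD.ReachesLocalMin f p.r (T p)
                (SaddleNGD.iterate f (η p) (θ p) (N₀ p) x₀ (fun t => n t ω))} := by
  have hd : ∀ p : SaddleNGD.Params, (0 : ℝ) < p.d := fun p => by linarith [p.one_le_d]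
  have hH : ∀ p : SaddleNGD.Params, 0 < p.hidden := fun p => by linarith [p.one_le_hidden]
  have hbar : ∀ p : SaddleNGD.Params, 1 / (p.hidden ^ 64 * (p.d : ℝ) ^ 2) ≤ 1 / (p.d : ℝ) ^ 2 :=
    fun p => one_div_le_one_div_of_le (pow_pos (hd p) 2)
      (le_mul_of_one_le_left (sq_nonneg _) (one_le_pow₀ p.one_le_hidden))
  refine ⟨fun p => 1 / (p.hidden ^ 64 * (p.d : ℝ) ^ 2), ⟨⟨1, 0, one_pos, fun p => ?_⟩,
    ⟨1, 64, one_pos, fun p => ?_⟩⟩, fun ηmax s hηmax hle hs => ?_⟩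
  · simpa using hbar p
  · have := hd p
    have := hH p
    refine le_of_eq ?_
    field_simp
  obtain ⟨C, k, hC, hmin⟩ := SaddleNGD.exists_learningRate_lower_bound hηmax.2 hs.2
  set η : SaddleNGD.Params → ℝ := fun p => min (ηmax p) (s p) with hη
  have hη0 : ∀ p, 0 < η p := fun p => (hmin p).1
  have hηle : ∀ p, η p ≤ 1 / (p.hidden ^ 64 * (p.d : ℝ) ^ 2) := fun p =>
    (min_le_left _ _).trans (hle p)
  have hη1 : ∀ p, η p ≤ 1 := fun p => by
    linarith [(p.period_conditions (hη0 p) (hηle p)).1]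
  have hrpow : ∀ p, η p ^ (-(1 / 2) : ℝ) = 1 / √(η p) := fun p => by
    rw [Real.rpow_neg (hη0 p).le, ← Real.sqrt_eq_rpow, one_div]
  have hT := fun p : SaddleNGD.Params => p.totalSteps_le (hη0 p) (hηle p) hC (hmin p).2
  have hconst : 0 < 6 * (16 * (1 + 8 * (|Real.log C| + k + 2)) + 1) * C ^ 2 := by positivity
  refine ⟨η, fun p => η p * p.noiseFactor, fun p => SaddleNGD.Params.periodLength (η p),
    fun p => p.totalSteps (η p), fun p => rfl, ⟨⟨97, 2, by norm_num, fun p => ?_⟩,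
    ⟨1, 0, one_pos, fun p => ?_⟩⟩, ⟨⟨2, 0, two_pos, fun p => ?_⟩, ⟨1, 0, one_pos, fun p => ?_⟩⟩,
    ⟨_, 2 * k + 4, hconst, fun p => (hT p).trans ?_⟩, ⟨_, _, hconst, hT⟩,
    fun p f hf x₀ Ω _ P _ n hn =>
      SaddleNGD.Params.le_measureReal_reachesLocalMin_totalSteps (hη0 p) (hηle p) hf x₀ P hn⟩
  · change η p * p.noiseFactor ≤ _
    rw [mul_comm]
    exact mul_le_mul_of_nonneg_right p.noiseFactor_le (hη0 p).le
  · rw [pow_zero, mul_one, one_mul]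
    exact le_mul_of_one_le_right (hη0 p).le p.one_le_noiseFactor
  · have := (SaddleNGD.Params.periodLength_bounds (hη0 p) (hη1 p)).2
    change _ ≤ 2 * p.hidden ^ 0 * η p ^ (-(1 / 2) : ℝ)
    rw [hrpow]
    linarith [mul_one_div 2 √(η p)]
  · have := (SaddleNGD.Params.periodLength_bounds (hη0 p) (hη1 p)).1
    change η p ^ (-(1 / 2) : ℝ) ≤ _
    rw [hrpow]
    linarith
  · have hηmax0 : 0 < ηmax p := (hη0 p).trans_le (min_le_left _ _)
    have hpos := hH p
    refine mul_le_mul_of_nonneg_left ?_ (by positivity)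
    -- The bound by `d³` is the stronger one: `ηmax ≤ 1/d²` gives `d³ ≤ ηmax^(-3/2)`.
    have h1 : (p.d : ℝ) ^ 3 = (1 / (p.d : ℝ) ^ 2) ^ (-(3 / 2) : ℝ) := by
      rw [one_div, Real.inv_rpow (by positivity), Real.rpow_neg (by positivity), inv_inv,
        ← Real.rpow_natCast, ← Real.rpow_natCast, ← Real.rpow_mul (hd p).le]
      norm_num
    rw [h1]
    exact Real.rpow_le_rpow_of_nonpos hηmax0 ((hle p).trans (hbar p)) (by norm_num)
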